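/- A \emph{lattice polygon} is a two-dimensional polytope $P\subset\mathbb{R}^2$ that is the convex hull of finitely many points of $\mathbb{Z}^2$. It is \emph{smooth} if every cone in its normal fan is unimodular, i.e. generated by a subset of a basis of $\mathbb{Z}^2$. Two lattice polygons $P,Q\subset\mathbb{R}^2$ are \emph{integrally equivalent} if there is an affine bijection $\mathbb{R}^2\to\mathbb{R}^2$ that maps $\mathbb{Z}^2$ onto $\mathbb{Z}^2$ and $P$ onto $Q$. \textbf{Theorem.} There are exactly $41$ integral equivalence classes of smooth lattice polygons $P$ with at most $12$ lattice points, i.e. with $|P\cap\mathbb{Z}^2|\le 12$. The number of these classes whose members have exactly $n$ vertices is $3$ for $n=3$, $30$ for $n=4$, $3$ for $n=5$, $4$ for $n=6$, $0$ for $n=7$, $1$ for $n=8$, and $0$ for every $n\ge 9$. -/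

import Mathlib

/-- The inclusion of `ℤ^d` into `ℝ^d`. -/
def intVec {d : ℕ} (z : Fin d → ℤ) : Fin d → ℝ := fun i => (z i : ℝ)

/-- The lattice `ℤ^d`, as a subset of `ℝ^d`. -/
def latticeSet (d : ℕ) : Set (Fin d → ℝ) := Set.range intVec

/-- `P` is a full-dimensional lattice polytope in `ℝ^d`: the convex hull of finitely many points
of `ℤ^d`, with affine span the whole space. For `d = 2` these are the lattice polygons. -/
def IsLatticePolytope {d : ℕ} (P : Set (Fin d → ℝ)) : Prop :=
  (∃ S : Finset (Fin d → ℤ), P = convexHull ℝ (intVec '' (S : Set (Fin d → ℤ)))) ∧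
    affineSpan ℝ P = ⊤

/-- The (inner) normal cone of `P` at a face `F`: the functionals (identified with vectors through
the standard dot product) that attain their minimum over `P` at every point of `F`. At a vertex it
is the dual cone of the tangent cone. -/
def normalCone {d : ℕ} (P F : Set (Fin d → ℝ)) : Set (Fin d → ℝ) :=
  {w | ∀ u ∈ F, ∀ x ∈ P, w ⬝ᵥ u ≤ w ⬝ᵥ x}

/-- The normal fan of `P`: the normal cones at all nonempty faces of `P`. -/
def normalFan {d : ℕ} (P : Set (Fin d → ℝ)) : Set (Set (Fin d → ℝ)) :=
  {σ | ∃ F : Set (Fin d → ℝ), F.Nonempty ∧ IsExposed ℝ P F ∧ σ = normalCone P F}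

/-- A cone is unimodular if it is generated by a subset of a basis of the lattice `ℤ^d` (the members
of that subset are then its primitive minimal generators; for a cone of dimension `d` they form
a lattice basis). -/
def IsUnimodularCone {d : ℕ} (σ : Set (Fin d → ℝ)) : Prop :=
  ∃ (b : Module.Basis (Fin d) ℤ (Fin d → ℤ)) (I : Set (Fin d)),
    σ = (PointedCone.hull ℝ ((fun i => intVec (b i)) '' I) : Set (Fin d → ℝ))

/-- A lattice polytope is smooth if every cone in its normal fan is unimodular. -/
def IsSmoothPolytope {d : ℕ} (P : Set (Fin d → ℝ)) : Prop :=
  ∀ σ ∈ normalFan P, IsUnimodularCone σ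

/-- Integral equivalence of full-dimensional lattice polytopes in `ℝ^d` (so that the affine span of
each of them is `ℝ^d`): an affine bijection of `ℝ^d` maps `ℤ^d` onto `ℤ^d` and `P` onto `Q`. -/
def IntegrallyEquivalent {d : ℕ} (P Q : Set (Fin d → ℝ)) : Prop :=
  ∃ f : (Fin d → ℝ) ≃ᵃ[ℝ] (Fin d → ℝ), f '' latticeSet d = latticeSet d ∧ f '' P = Q

theorem IntegrallyEquivalent.rfl' {d : ℕ} (P : Set (Fin d → ℝ)) : IntegrallyEquivalent P P :=
  ⟨AffineEquiv.refl ℝ _, by simp, by simp⟩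

theorem IntegrallyEquivalent.symm' {d : ℕ} {P Q : Set (Fin d → ℝ)}
    (h : IntegrallyEquivalent P Q) : IntegrallyEquivalent Q P := by
  obtain ⟨f, hL, hP⟩ := h
  have key : ∀ A B : Set (Fin d → ℝ), f '' A = B → f.symm '' B = A := by
    rintro A _ rfl
    rw [Set.image_image]
    simp
  exact ⟨f.symm, key _ _ hL, key _ _ hP⟩

theorem IntegrallyEquivalent.trans' {d : ℕ} {P Q R : Set (Fin d → ℝ)}
    (h : IntegrallyEquivalent P Q) (h' : IntegrallyEquivalent Q R) : IntegrallyEquivalent P R := by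
  obtain ⟨f, hL, rfl⟩ := h
  obtain ⟨g, hL', rfl⟩ := h'
  refine ⟨f.trans g, ?_, ?_⟩
  · rw [AffineEquiv.coe_trans, Set.image_comp, hL, hL']
  · rw [AffineEquiv.coe_trans, Set.image_comp]

/-- Smooth lattice polygons in `ℝ²`. -/
def SmoothPolygon : Type :=
  {P : Set (Fin 2 → ℝ) // IsLatticePolytope P ∧ IsSmoothPolytope P}

instance smoothPolygonSetoid : Setoid SmoothPolygon where
  r P Q := IntegrallyEquivalent P.1 Q.1
  iseqv := ⟨fun P => .rfl' P.1, fun h => h.symm', fun h h' => h.trans' h'⟩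

/-- The number of lattice points of a smooth polygon. -/
noncomputable def SmoothPolygon.numLatticePoints (P : SmoothPolygon) : ℕ∞ :=
  (P.1 ∩ latticeSet 2).encard

/-- The number of vertices of a smooth polygon. -/
noncomputable def SmoothPolygon.numVertices (P : SmoothPolygon) : ℕ∞ :=
  (P.1.extremePoints ℝ).encard

/-- The integral equivalence classes of smooth lattice polygons with at most `N` lattice points. -/
def smoothPolygonClasses (N : ℕ) : Set (Quotient smoothPolygonSetoid) :=
  {c | ∃ P : SmoothPolygon, P.numLatticePoints ≤ N ∧ c = ⟦P⟧}

/-- The integral equivalence classes of smooth lattice polygons with at most `N` lattice points and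
exactly `n` vertices. -/
def smoothPolygonClassesWithVertices (N n : ℕ) : Set (Quotient smoothPolygonSetoid) :=
  {c | ∃ P : SmoothPolygon, P.numLatticePoints ≤ N ∧ P.numVertices = n ∧ c = ⟦P⟧}


/-! A smooth polygon is determined by its lattice points, and smoothness at a vertex `v` means that
the primitive directions of the two edges at `v` form a basis of `ℤ²`. Choosing coordinates adapted
to one vertex, we walk counterclockwise round the boundary. At a vertex entered in the direction `u`
and followed by an edge of direction `w` we have `det (u, w) = 1`, so that only one integer
parameter is free at each turn, besides the length of each edge. The bound on the number of lattice
points leaves finitely many walks, and each of them closes up to a polygon of an explicit list. The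
polygons of this list are told apart by the number of vertices and the sum of the cubes of the
lattice lengths of the segments joining vertices.
-/

section LatticeVectors

variable {d : ℕ}

theorem intVec_injective : Function.Injective (intVec : (Fin d → ℤ) → Fin d → ℝ) := fun _ _ h =>
  funext fun i => Int.cast_injective (congrFun h i)

theorem intVec_zero : intVec (0 : Fin d → ℤ) = 0 := by
  ext i
  simp [intVec]

theorem intVec_add (x y : Fin d → ℤ) : intVec (x + y) = intVec x + intVec y := by
  ext i
  simp [intVec]

theorem intVec_sub (x y : Fin d → ℤ) : intVec (x - y) = intVec x - intVec y := by
  ext i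
  simp [intVec]

theorem intVec_zsmul (n : ℤ) (x : Fin d → ℤ) : intVec (n • x) = (n : ℝ) • intVec x := by
  ext i
  simp [intVec]

theorem intVec_dotProduct_intVec (x y : Fin d → ℤ) :
    intVec x ⬝ᵥ intVec y = ((x ⬝ᵥ y : ℤ) : ℝ) := by
  simp [intVec, dotProduct]

/-- The extension of a `ℤ`-linear endomorphism of `ℤ^d` to `ℝ^d`. -/
noncomputable def realExtension (f : (Fin d → ℤ) →ₗ[ℤ] Fin d → ℤ) :
    (Fin d → ℝ) →ₗ[ℝ] Fin d → ℝ :=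
  ((LinearMap.toMatrix' f).map (Int.castRingHom ℝ)).toLin'

theorem realExtension_intVec (f : (Fin d → ℤ) →ₗ[ℤ] Fin d → ℤ) (x : Fin d → ℤ) :
    realExtension f (intVec x) = intVec (f x) := by
  conv_rhs => rw [← LinearMap.toMatrix'_mulVec f x]
  ext i
  simp [realExtension, intVec, Matrix.mulVec, dotProduct]

theorem realExtension_id :
    realExtension (LinearMap.id : (Fin d → ℤ) →ₗ[ℤ] Fin d → ℤ) = LinearMap.id := by
  simp [realExtension]

theorem realExtension_comp (f g : (Fin d → ℤ) →ₗ[ℤ] Fin d → ℤ) :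
    realExtension (f ∘ₗ g) = realExtension f ∘ₗ realExtension g := by
  rw [realExtension, LinearMap.toMatrix'_comp, Matrix.map_mul, Matrix.toLin'_mul]
  rfl

/-- The extension of a `ℤ`-linear automorphism of `ℤ^d` to `ℝ^d`. -/
noncomputable def realExtensionEquiv (f : (Fin d → ℤ) ≃ₗ[ℤ] Fin d → ℤ) :
    (Fin d → ℝ) ≃ₗ[ℝ] Fin d → ℝ :=
  .ofLinearMap (realExtension f) (realExtension f.symm)
    (by rw [← realExtension_comp, LinearEquiv.comp_coe, LinearEquiv.symm_trans_self,
      LinearEquiv.refl_toLinearMap, realExtension_id])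
    (by rw [← realExtension_comp, LinearEquiv.comp_coe, LinearEquiv.self_trans_symm,
      LinearEquiv.refl_toLinearMap, realExtension_id])

theorem realExtensionEquiv_intVec (f : (Fin d → ℤ) ≃ₗ[ℤ] Fin d → ℤ) (x : Fin d → ℤ) :
    realExtensionEquiv f (intVec x) = intVec (f x) :=
  realExtension_intVec _ x

/-- A basis of `ℤ^d`, regarded as a basis of `ℝ^d`. -/
noncomputable def realBasis (b : Module.Basis (Fin d) ℤ (Fin d → ℤ)) :
    Module.Basis (Fin d) ℝ (Fin d → ℝ) :=
  (Pi.basisFun ℝ (Fin d)).map (realExtensionEquiv b.equivFun.symm)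

theorem realBasis_apply (b : Module.Basis (Fin d) ℤ (Fin d → ℤ)) (i : Fin d) :
    realBasis b i = intVec (b i) := by
  have hsingle : Pi.basisFun ℝ (Fin d) i = intVec (Pi.single i 1) := by
    ext j
    simp [intVec, Pi.single_apply]
  rw [realBasis, Module.Basis.map_apply, hsingle, realExtensionEquiv_intVec,
    Module.Basis.equivFun_symm_apply]
  simp [Pi.single_apply]

theorem exists_dual_basis (e : Module.Basis (Fin d) ℤ (Fin d → ℤ)) :
    ∃ b : Module.Basis (Fin d) ℤ (Fin d → ℤ), ∀ i x, b i ⬝ᵥ x = e.repr x i := by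
  refine ⟨e.dualBasis.map (dotProductEquiv ℤ (Fin d)).symm, fun i x => ?_⟩
  rw [← dotProductEquiv_apply_apply, Module.Basis.map_apply, LinearEquiv.apply_symm_apply,
    Module.Basis.dualBasis_apply]

theorem exists_basis_dual_to (b : Module.Basis (Fin d) ℤ (Fin d → ℤ)) :
    ∃ e : Module.Basis (Fin d) ℤ (Fin d → ℤ), ∀ i x, b i ⬝ᵥ x = e.repr x i := by
  let coordinates := (Module.evalEquiv ℤ (Fin d → ℤ)).trans
    (b.map (dotProductEquiv ℤ (Fin d))).dualBasis.equivFun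
  refine ⟨.ofEquivFun coordinates, fun i x => ?_⟩
  change _ = (b.map (dotProductEquiv ℤ (Fin d))).dualBasis.repr (Module.evalEquiv ℤ _ x) i
  rw [Module.Basis.dualBasis_repr]
  rfl

end LatticeVectors

section SmoothVertices

variable {ι M M' : Type*} [AddCommGroup M] [AddCommGroup M']

/-- The basis `e` generates the edges of `S` at the vertex `v`: the set `S` lies in the cone with
apex `v` spanned by `e`, and has a point other than `v` on every ray of this cone. Here `S` may be
the set of vertices of a polytope as well as the set of all its lattice points. -/
structure IsSmoothVertex (S : Set M) (e : Module.Basis ι ℤ M) (v : M) : Prop where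
  mem : v ∈ S
  repr_sub_nonneg : ∀ x ∈ S, ∀ i, 0 ≤ e.repr (x - v) i
  exists_add_smul_mem : ∀ i, ∃ k : ℤ, 0 < k ∧ v + k • e i ∈ S

theorem IsSmoothVertex.reindex {ι' : Type*} {S : Set M} {e : Module.Basis ι ℤ M} {v : M}
    (h : IsSmoothVertex S e v) (σ : ι ≃ ι') : IsSmoothVertex S (e.reindex σ) v where
  mem := h.mem
  repr_sub_nonneg x hx i := by
    rw [Module.Basis.repr_reindex_apply]
    exact h.repr_sub_nonneg x hx _
  exists_add_smul_mem i := by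
    rw [Module.Basis.reindex_apply]
    exact h.exists_add_smul_mem _

/-- Every point of `S` at which a linear functional has a strict minimum on `S` is a smooth
vertex. -/
def HasSmoothVertices (ι : Type*) (S : Set M) : Prop :=
  ∀ v ∈ S, (∃ ℓ : M →ₗ[ℤ] ℤ, ∀ x ∈ S, x ≠ v → 0 < ℓ (x - v)) →
    ∃ e : Module.Basis ι ℤ M, IsSmoothVertex S e v

theorem affineEquiv_add (φ : M ≃ᵃ[ℤ] M') (x y : M) : φ (x + y) = φ x + φ.linear y := by
  rw [add_comm x, ← vadd_eq_add, AffineEquiv.map_vadd, vadd_eq_add, add_comm]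

theorem affineEquiv_sub (φ : M ≃ᵃ[ℤ] M') (x y : M) : φ x - φ y = φ.linear (x - y) :=
  (φ.toAffineMap.linearMap_vsub x y).symm

theorem IsSmoothVertex.image {S : Set M} {e : Module.Basis ι ℤ M} {v : M}
    (h : IsSmoothVertex S e v) (φ : M ≃ᵃ[ℤ] M') :
    IsSmoothVertex (φ '' S) (e.map φ.linear) (φ v) where
  mem := Set.mem_image_of_mem φ h.mem
  repr_sub_nonneg := by
    rintro _ ⟨x, hx, rfl⟩ i
    simpa [affineEquiv_sub] using h.repr_sub_nonneg x hx i
  exists_add_smul_mem i := by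
    obtain ⟨k, hk, hmem⟩ := h.exists_add_smul_mem i
    exact ⟨k, hk, v + k • e i, hmem, by simp [affineEquiv_add]⟩

theorem HasSmoothVertices.image {S : Set M} (h : HasSmoothVertices ι S) (φ : M ≃ᵃ[ℤ] M') :
    HasSmoothVertices ι (φ '' S) := by
  rintro _ ⟨v, hv, rfl⟩ ⟨ℓ, hℓ⟩
  have hmin : ∀ x ∈ S, x ≠ v → 0 < (ℓ ∘ₗ φ.linear) (x - v) := fun x hx hxv => by
    simpa [affineEquiv_sub] using hℓ (φ x) ⟨x, hx, rfl⟩ (φ.injective.ne hxv)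
  obtain ⟨e, he⟩ := h v hv ⟨_, hmin⟩
  exact ⟨e.map φ.linear, he.image φ⟩

/-- A set containing the lattice points of each segment that joins two of its points. -/
def IsSegmentClosed (S : Set M) : Prop :=
  ∀ ⦃x u : M⦄ ⦃k n : ℕ⦄, x ∈ S → x + n • u ∈ S → k ≤ n → x + k • u ∈ S

theorem IsSegmentClosed.image {S : Set M} (h : IsSegmentClosed S) (φ : M ≃ᵃ[ℤ] M') :
    IsSegmentClosed (φ '' S) := by
  rintro _ u k n ⟨x, hx, rfl⟩ hxu hkn
  have hφ : ∀ m : ℕ, φ x + m • u = φ (x + m • φ.linear.symm u) := fun m => by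
    simp [affineEquiv_add]
  rw [hφ] at hxu ⊢
  exact Set.mem_image_of_mem φ (h hx ((φ.injective.mem_set_image).1 hxu) hkn)

theorem IsSmoothVertex.add_mem {S : Set M} {e : Module.Basis ι ℤ M} {v : M}
    (h : IsSmoothVertex S e v) (hS : IsSegmentClosed S) (i : ι) : v + e i ∈ S := by
  obtain ⟨k, hk, hmem⟩ := h.exists_add_smul_mem i
  lift k to ℕ using hk.le
  rw [natCast_zsmul] at hmem
  simpa using hS (k := 1) h.mem hmem (by omega)

/-- Lexicographic minimization of `g`, then `h`, as the minimization of a single combination. -/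
theorem exists_forall_pos_mul_add {α : Type*} {A : Set α} (hA : A.Finite) {g h : α → ℤ}
    (hgh : ∀ x ∈ A, 0 < g x ∨ g x = 0 ∧ 0 < h x) : ∃ n : ℕ, ∀ x ∈ A, 0 < n * g x + h x := by
  obtain ⟨n, hn⟩ := (hA.image fun x => (h x).natAbs).bddAbove
  refine ⟨n + 1, fun x hx => ?_⟩
  have hbound : ((h x).natAbs : ℤ) ≤ n := mod_cast hn ⟨x, hx, rfl⟩
  rcases hgh x hx with hg | ⟨hg, hh⟩
  · push_cast
    nlinarith [neg_abs_le (h x), Int.natCast_natAbs (h x)]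
  · rw [hg]
    omega

end SmoothVertices

section LatticePolytopes

variable {d : ℕ}

/-- The lattice points of a subset of `ℝ^d`, as elements of `ℤ^d`. -/
def latticePoints (P : Set (Fin d → ℝ)) : Set (Fin d → ℤ) := intVec ⁻¹' P

/-- The convex hull in `ℝ^d` of a set of lattice points. -/
def latticePolytope (S : Set (Fin d → ℤ)) : Set (Fin d → ℝ) := convexHull ℝ (intVec '' S)

theorem encard_inter_latticeSet (P : Set (Fin d → ℝ)) :
    (P ∩ latticeSet d).encard = (latticePoints P).encard := by
  rw [latticeSet, ← Set.image_preimage_eq_inter_range, intVec_injective.injOn.encard_image]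
  rfl

theorem subset_latticePoints_latticePolytope (S : Set (Fin d → ℤ)) :
    S ⊆ latticePoints (latticePolytope S) :=
  Set.image_subset_iff.1 (subset_convexHull ℝ (intVec '' S))

theorem latticePolytope_eq_of_subset {S T : Set (Fin d → ℤ)} (hST : S ⊆ T)
    (hTS : T ⊆ latticePoints (latticePolytope S)) : latticePolytope S = latticePolytope T :=
  (convexHull_mono (Set.image_mono hST)).antisymm
    (convexHull_min (Set.image_subset_iff.2 hTS) (convex_convexHull ℝ _))

theorem IsLatticePolytope.latticePolytope_latticePoints {P : Set (Fin d → ℝ)}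
    (hP : IsLatticePolytope P) : latticePolytope (latticePoints P) = P := by
  obtain ⟨⟨S, rfl⟩, -⟩ := hP
  exact (latticePolytope_eq_of_subset (subset_latticePoints_latticePolytope _) subset_rfl).symm

theorem IsLatticePolytope.nonempty_latticePoints {P : Set (Fin d → ℝ)}
    (hP : IsLatticePolytope P) : (latticePoints P).Nonempty := by
  rw [Set.nonempty_iff_ne_empty]
  intro hempty
  have hspan := hP.2
  rw [← hP.latticePolytope_latticePoints, hempty, latticePolytope, Set.image_empty,
    convexHull_empty, AffineSubspace.span_empty] at hspan
  exact AffineSubspace.bot_ne_top ℝ _ _ hspan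

theorem isSegmentClosed_latticePoints {P : Set (Fin d → ℝ)} (hP : Convex ℝ P) :
    IsSegmentClosed (latticePoints P) := by
  intro x u k n hx hxu hkn
  rcases n.eq_zero_or_pos with rfl | hn
  · rwa [Nat.le_zero.1 hkn]
  have hn' : (0 : ℝ) < n := mod_cast hn
  simp only [latticePoints, Set.mem_preimage, ← natCast_zsmul, intVec_add, intVec_zsmul,
    Int.cast_natCast] at *
  have := hP.add_smul_mem hx hxu (t := (k : ℝ) / n)
    ⟨by positivity, (div_le_one hn').2 (mod_cast hkn)⟩
  rwa [smul_smul, div_mul_cancel₀ _ hn'.ne'] at this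

theorem mem_latticePoints_of_smul_eq {P : Set (Fin d → ℝ)} (hP : Convex ℝ P)
    {x y z : Fin d → ℤ} (hy : y ∈ latticePoints P) (hz : z ∈ latticePoints P)
    (h0 : 0 ∈ latticePoints P) {n a b : ℤ} (hn : 0 < n) (ha : 0 ≤ a) (hb : 0 ≤ b)
    (hab : a + b ≤ n) (hx : n • x = a • y + b • z) : x ∈ latticePoints P := by
  have hn' : (0 : ℝ) < n := mod_cast hn
  have ha' : (0 : ℝ) ≤ a := mod_cast ha
  have hb' : (0 : ℝ) ≤ b := mod_cast hb
  have hab' : (a + b : ℝ) ≤ n := mod_cast hab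
  have hx' := congrArg intVec hx
  rw [intVec_add, intVec_zsmul, intVec_zsmul, intVec_zsmul] at hx'
  have hcombo : intVec x = ∑ i, ![(a : ℝ) / n, b / n, (n - a - b) / n] i •
      ![intVec y, intVec z, intVec 0] i := by
    rw [← inv_smul_smul₀ hn'.ne' (intVec x), hx']
    simp [Fin.sum_univ_three, intVec_zero, smul_smul, div_eq_inv_mul]
  change intVec x ∈ P
  rw [hcombo]
  refine hP.sum_mem (fun i _ => ?_) ?_ fun i _ => ?_
  · fin_cases i
    exacts [div_nonneg ha' hn'.le, div_nonneg hb' hn'.le, div_nonneg (by linarith) hn'.le]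
  · have : (a : ℝ) / n + b / n + (n - a - b) / n = 1 := by
      field_simp
      ring
    simpa [Fin.sum_univ_three] using this
  · fin_cases i
    exacts [hy, hz, h0]

theorem mem_normalCone_singleton_iff {S : Set (Fin d → ℤ)} {v : Fin d → ℤ} {w : Fin d → ℝ} :
    w ∈ normalCone (latticePolytope S) {intVec v} ↔ ∀ x ∈ S, 0 ≤ w ⬝ᵥ intVec (x - v) := by
  simp only [intVec_sub, dotProduct_sub, sub_nonneg]
  refine ⟨fun h x hx => h _ rfl _ (subset_latticePoints_latticePolytope S hx), ?_⟩
  rintro h _ rfl x hx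
  refine convexHull_min ?_
    (convex_halfSpace_ge (dotProductEquiv ℝ _ w).isLinear (w ⬝ᵥ intVec v)) hx
  rintro _ ⟨y, hy, rfl⟩
  exact h y hy

theorem convexHull_subset_insert {E : Type*} [AddCommGroup E] [Module ℝ E] (f : E →ₗ[ℝ] ℝ)
    {A : Set E} {v : E} (hA : ∀ x ∈ A, x ≠ v → f v < f x) :
    convexHull ℝ A ⊆ insert v {x | f v < f x} := by
  refine convexHull_min (fun x hx => or_iff_not_imp_left.2 (hA x hx)) ?_
  refine convex_iff_forall_pos.2 fun x hx y hy a b ha hb hab => ?_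
  have hv : f v = a * f v + b * f v := by rw [← add_mul, hab, one_mul]
  rcases hx with rfl | hx <;> rcases hy with rfl | hy
  · exact .inl (Convex.combo_self hab _)
  all_goals
    right
    simp only [Set.mem_ofPred_eq, map_add, map_smul, smul_eq_mul] at *
    nlinarith

theorem isExposed_singleton_of_forall_pos {S : Set (Fin d → ℤ)} {v : Fin d → ℤ} (hv : v ∈ S)
    {c : Fin d → ℤ} (hc : ∀ x ∈ S, x ≠ v → 0 < c ⬝ᵥ (x - v)) :
    IsExposed ℝ (latticePolytope S) {intVec v} := by
  let f := dotProductEquiv ℝ (Fin d) (intVec c)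
  have hsub : latticePolytope S ⊆ insert (intVec v) {x | f (intVec v) < f x} := by
    refine convexHull_subset_insert f ?_
    rintro _ ⟨x, hx, rfl⟩ hxv
    have := hc x hx (by rintro rfl; exact hxv rfl)
    rw [dotProduct_sub, sub_pos] at this
    simp only [f, dotProductEquiv_apply_apply, intVec_dotProduct_intVec]
    exact_mod_cast this
  refine fun _ => ⟨-f.toContinuousLinearMap, Set.eq_of_subset_of_subset ?_ ?_⟩
  · rintro _ rfl
    refine ⟨subset_latticePoints_latticePolytope S hv, fun y hy => neg_le_neg ?_⟩
    rcases hsub hy with rfl | hy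
    exacts [le_rfl, le_of_lt hy]
  · rintro x ⟨hx, hmax⟩
    have hle : f x ≤ f (intVec v) :=
      neg_le_neg_iff.1 (hmax _ (subset_latticePoints_latticePolytope S hv))
    exact (hsub hx).resolve_right hle.not_gt

end LatticePolytopes

section SmoothPolytopes

variable {d : ℕ} {b e : Module.Basis (Fin d) ℤ (Fin d → ℤ)}

theorem dotProduct_intVec_eq_repr_realBasis (hbe : ∀ i x, b i ⬝ᵥ x = e.repr x i) (w : Fin d → ℝ)
    (i : Fin d) : w ⬝ᵥ intVec (e i) = (realBasis b).repr w i := by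
  conv_lhs => rw [← (realBasis b).sum_repr w]
  simp [sum_dotProduct, realBasis_apply, intVec_dotProduct_intVec, hbe, Finsupp.single_apply]

theorem dotProduct_eq_sum_mul (hbe : ∀ i x, b i ⬝ᵥ x = e.repr x i) (w y : Fin d → ℝ) :
    w ⬝ᵥ y = ∑ i, (w ⬝ᵥ intVec (e i)) * (intVec (b i) ⬝ᵥ y) := by
  conv_lhs => rw [← (realBasis b).sum_repr w]
  simp [sum_dotProduct, realBasis_apply, dotProduct_intVec_eq_repr_realBasis hbe]

theorem mem_hull_basis_iff (hbe : ∀ i x, b i ⬝ᵥ x = e.repr x i) {I : Set (Fin d)}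
    {w : Fin d → ℝ} : w ∈ PointedCone.hull ℝ ((fun i => intVec (b i)) '' I) ↔
      (∀ i, 0 ≤ w ⬝ᵥ intVec (e i)) ∧ ∀ i ∉ I, w ⬝ᵥ intVec (e i) = 0 := by
  constructor
  · intro hw
    induction hw using Submodule.span_induction with
    | mem x hx =>
      obtain ⟨i, hi, rfl⟩ := hx
      simp only [intVec_dotProduct_intVec, hbe, e.repr_self, Finsupp.single_apply,
        Int.cast_ite, Int.cast_one, Int.cast_zero]
      exact ⟨fun j => by split <;> simp,
        fun j hj => if_neg (by rintro rfl; exact hj hi)⟩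
    | zero => simp
    | add x y _ _ hx hy =>
      exact ⟨fun i => by rw [add_dotProduct]; exact add_nonneg (hx.1 i) (hy.1 i),
        fun i hi => by rw [add_dotProduct, hx.2 i hi, hy.2 i hi, add_zero]⟩
    | smul t x _ hx =>
      exact ⟨fun i => by rw [smul_dotProduct]; exact smul_nonneg t.2 (hx.1 i),
        fun i hi => by rw [smul_dotProduct, hx.2 i hi, smul_zero]⟩
  · rintro ⟨hnonneg, hzero⟩
    rw [← (realBasis b).sum_repr w]
    refine Submodule.sum_mem _ fun i _ => ?_
    rw [← dotProduct_intVec_eq_repr_realBasis hbe, realBasis_apply]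
    by_cases hi : i ∈ I
    · exact Submodule.smul_mem _ (⟨_, hnonneg i⟩ : {c : ℝ // 0 ≤ c})
        (Submodule.subset_span ⟨i, hi, rfl⟩)
    · rw [hzero i hi, zero_smul]
      exact zero_mem _

theorem exists_forall_nonneg_smul_sub {S : Set (Fin d → ℤ)} (hS : S.Finite) {v c : Fin d → ℤ}
    (hc : ∀ x ∈ S, x ≠ v → 0 < c ⬝ᵥ (x - v)) (a : Fin d → ℤ) :
    ∃ n : ℤ, ∀ x ∈ S, 0 ≤ (n • c - a) ⬝ᵥ (x - v) := by
  obtain ⟨n, hn⟩ := exists_forall_pos_mul_add (hS.subset Set.sdiff_subset)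
    (g := fun x => c ⬝ᵥ (x - v)) (h := fun x => -(a ⬝ᵥ (x - v)))
    fun x (hx : x ∈ S \ {v}) => .inl (hc x hx.1 hx.2)
  refine ⟨n, fun x hx => ?_⟩
  by_cases hxv : x = v
  · simp [hxv]
  · have := hn x ⟨hx, hxv⟩
    simp only [sub_dotProduct, smul_dotProduct, smul_eq_mul]
    omega

theorem isSmoothVertex_of_forall_nonneg_iff {S : Set (Fin d → ℤ)} (hS : S.Finite) {v : Fin d → ℤ}
    (hv : v ∈ S) (h : ∀ a : Fin d → ℤ, (∀ x ∈ S, 0 ≤ a ⬝ᵥ (x - v)) ↔ ∀ i, 0 ≤ a ⬝ᵥ e i) :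
    IsSmoothVertex S e v := by
  obtain ⟨b, hbe⟩ := exists_dual_basis e
  have hbasis : ∀ i j, b i ⬝ᵥ e j = if j = i then 1 else 0 := fun i j => by
    rw [hbe, e.repr_self, Finsupp.single_apply]
  have hnonneg : ∀ x ∈ S, ∀ i, 0 ≤ e.repr (x - v) i := fun x hx i => by
    rw [← hbe]
    exact (h (b i)).2 (fun j => by rw [hbasis]; split <;> simp) x hx
  refine ⟨hv, hnonneg, fun i => ?_⟩
  by_contra! hray
  -- For large `n`, `n • ∑ j ≠ i, b j - b i` is nonnegative on every `x - v`, yet negative on `e i`.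
  have hother : ∀ x ∈ S, x ≠ v → 0 < (∑ j ∈ {i}ᶜ, b j) ⬝ᵥ (x - v) := by
    intro x hx hxv
    simp only [sum_dotProduct, hbe]
    refine (Finset.sum_nonneg fun j _ => hnonneg x hx j).lt_of_ne fun hsum => ?_
    have hzero := (Finset.sum_eq_zero_iff_of_nonneg fun j _ => hnonneg x hx j).1 hsum.symm
    have hx_eq : x - v = e.repr (x - v) i • e i := by
      conv_lhs => rw [← e.sum_repr (x - v)]
      exact Finset.sum_eq_single i (fun j _ hji => by rw [hzero j (by simpa using hji), zero_smul])
        (by simp)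
    refine hray _ ((hnonneg x hx i).lt_of_ne fun hi => hxv ?_) (by rwa [← hx_eq, add_sub_cancel])
    rwa [← hi, zero_smul, sub_eq_zero] at hx_eq
  obtain ⟨n, hn⟩ := exists_forall_nonneg_smul_sub hS hother (b i)
  have hcontra := (h _).1 hn i
  have hsum : (∑ j ∈ {i}ᶜ, b j) ⬝ᵥ e i = 0 := by
    rw [sum_dotProduct]
    exact Finset.sum_eq_zero fun j hj => by
      rw [hbasis, if_neg (by rintro rfl; simp at hj)]
  rw [sub_dotProduct, smul_dotProduct, hsum, hbasis, if_pos rfl, smul_zero] at hcontra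
  omega

theorem exists_basis_forall_nonneg_iff {S : Set (Fin d → ℤ)} (hS : S.Finite)
    (hsmooth : IsSmoothPolytope (latticePolytope S)) {v c : Fin d → ℤ} (hv : v ∈ S)
    (hc : ∀ x ∈ S, x ≠ v → 0 < c ⬝ᵥ (x - v)) :
    ∃ e : Module.Basis (Fin d) ℤ (Fin d → ℤ), ∀ a : Fin d → ℤ,
      (∀ x ∈ S, 0 ≤ a ⬝ᵥ (x - v)) ↔ ∀ i, 0 ≤ a ⬝ᵥ e i := by
  obtain ⟨b, I, hbI⟩ := hsmooth _
    ⟨_, Set.singleton_nonempty _, isExposed_singleton_of_forall_pos hv hc, rfl⟩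
  obtain ⟨e, hbe⟩ := exists_basis_dual_to b
  have hcone : ∀ a : Fin d → ℤ, (∀ x ∈ S, 0 ≤ a ⬝ᵥ (x - v)) ↔
      (∀ i, 0 ≤ a ⬝ᵥ e i) ∧ ∀ i ∉ I, a ⬝ᵥ e i = 0 := fun a => by
    have := (mem_normalCone_singleton_iff (S := S) (v := v) (w := intVec a)).symm
    rw [hbI, SetLike.mem_coe, mem_hull_basis_iff hbe] at this
    simpa only [intVec_dotProduct_intVec, Int.cast_nonneg_iff, Int.cast_eq_zero] using this
  refine ⟨e, fun a => (hcone a).trans (and_iff_left_of_imp fun _ i hi => ?_)⟩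
  -- The cone is full-dimensional: it contains `n • c - b i` for all large `n`.
  obtain ⟨n, hn⟩ := exists_forall_nonneg_smul_sub hS hc (b i)
  have hc_mem : ∀ x ∈ S, 0 ≤ c ⬝ᵥ (x - v) := fun x hx => by
    by_cases hxv : x = v
    exacts [by simp [hxv], (hc x hx hxv).le]
  have hzero := ((hcone _).1 hn).2 i hi
  rw [sub_dotProduct, smul_dotProduct, ((hcone c).1 hc_mem).2 i hi, hbe, e.repr_self,
    Finsupp.single_eq_same, smul_zero] at hzero
  omega

theorem IsSmoothPolytope.hasSmoothVertices {S : Set (Fin d → ℤ)} (hS : S.Finite)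
    (hsmooth : IsSmoothPolytope (latticePolytope S)) : HasSmoothVertices (Fin d) S := by
  rintro v hv ⟨ℓ, hℓ⟩
  obtain ⟨e, he⟩ := exists_basis_forall_nonneg_iff hS hsmooth hv
    (c := (dotProductEquiv ℤ (Fin d)).symm ℓ) fun x hx hxv => by
      rw [← dotProductEquiv_apply_apply, LinearEquiv.apply_symm_apply]
      exact hℓ x hx hxv
  exact ⟨e, isSmoothVertex_of_forall_nonneg_iff hS hv he⟩

end SmoothPolytopes

section LatticePolytopesWithSmoothVertices

variable {d : ℕ} {S : Set (Fin d → ℤ)} {e : Module.Basis (Fin d) ℤ (Fin d → ℤ)} {v : Fin d → ℤ}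

theorem IsSmoothVertex.intVec_mem_extremePoints (h : IsSmoothVertex S e v) :
    intVec v ∈ (latticePolytope S).extremePoints ℝ := by
  obtain ⟨b, hbe⟩ := exists_dual_basis e
  have hpos : ∀ x ∈ S, x ≠ v → 0 < (∑ i, b i) ⬝ᵥ (x - v) := fun x hx hxv => by
    simp only [sum_dotProduct, hbe]
    refine (Finset.sum_nonneg fun i _ => h.repr_sub_nonneg x hx i).lt_of_ne fun hsum => hxv ?_
    have hzero := (Finset.sum_eq_zero_iff_of_nonneg fun i _ => h.repr_sub_nonneg x hx i).1 hsum.symm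
    rw [← sub_eq_zero, ← e.sum_repr (x - v)]
    exact Finset.sum_eq_zero fun i hi => by rw [hzero i hi, zero_smul]
  exact isExtreme_singleton.1 (isExposed_singleton_of_forall_pos h.mem hpos).isExtreme

theorem extremePoints_latticePolytope
    (hS : ∀ v ∈ S, ∃ e : Module.Basis (Fin d) ℤ (Fin d → ℤ), IsSmoothVertex S e v) :
    (latticePolytope S).extremePoints ℝ = intVec '' S := by
  refine extremePoints_convexHull_subset.antisymm ?_
  rintro _ ⟨v, hv, rfl⟩
  obtain ⟨e, he⟩ := hS v hv
  exact he.intVec_mem_extremePoints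

theorem IsSmoothVertex.affineSpan_eq_top (h : IsSmoothVertex S e v) :
    affineSpan ℝ (latticePolytope S) = ⊤ := by
  rw [latticePolytope, affineSpan_convexHull, ← AffineSubspace.direction_eq_top_iff_of_nonempty
    ((affineSpan_nonempty ℝ).2 (Set.Nonempty.image intVec ⟨v, h.mem⟩)), direction_affineSpan,
    eq_top_iff, ← (realBasis e).span_eq, Submodule.span_le]
  rintro _ ⟨i, rfl⟩
  obtain ⟨k, hk, hmem⟩ := h.exists_add_smul_mem i
  have hsub := vsub_mem_vectorSpan ℝ (Set.mem_image_of_mem intVec hmem)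
    (Set.mem_image_of_mem intVec h.mem)
  rw [vsub_eq_sub, ← intVec_sub, add_sub_cancel_left, intVec_zsmul, ← realBasis_apply] at hsub
  exact (Submodule.smul_mem_iff _ (by exact_mod_cast hk.ne')).1 hsub

theorem IsSmoothVertex.mem_normalCone_iff (h : IsSmoothVertex S e v) {w : Fin d → ℝ} :
    w ∈ normalCone (latticePolytope S) {intVec v} ↔ ∀ i, 0 ≤ w ⬝ᵥ intVec (e i) := by
  obtain ⟨b, hbe⟩ := exists_dual_basis e
  rw [mem_normalCone_singleton_iff]
  refine ⟨fun hw i => ?_, fun hw x hx => ?_⟩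
  · obtain ⟨k, hk, hmem⟩ := h.exists_add_smul_mem i
    have := hw _ hmem
    rw [add_sub_cancel_left, intVec_zsmul, dotProduct_smul] at this
    exact nonneg_of_mul_nonneg_right this (by exact_mod_cast hk)
  · rw [dotProduct_eq_sum_mul hbe]
    refine Finset.sum_nonneg fun i _ => mul_nonneg (hw i) ?_
    rw [intVec_dotProduct_intVec, hbe]
    exact_mod_cast h.repr_sub_nonneg x hx i

theorem mem_normalCone_iff_of_mem {P F : Set (Fin d → ℝ)} (hF : F ⊆ P) {p w : Fin d → ℝ}
    (hp : p ∈ F) : w ∈ normalCone P F ↔ w ∈ normalCone P {p} ∧ ∀ u ∈ F, w ⬝ᵥ (u - p) = 0 := by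
  simp only [normalCone, Set.mem_ofPred_eq, Set.mem_singleton_iff, forall_eq, dotProduct_sub,
    sub_eq_zero]
  exact ⟨fun h => ⟨h p hp, fun u hu => (h u hu p (hF hp)).antisymm (h p hp u (hF hu))⟩,
    fun h u hu x hx => (h.2 u hu).trans_le (h.1 x hx)⟩

/-- The cone at a face `F` containing a smooth vertex is generated by the dual basis vectors that
are constant on `F`. -/
theorem IsSmoothVertex.isUnimodularCone_normalCone (h : IsSmoothVertex S e v)
    {F : Set (Fin d → ℝ)} (hF : F ⊆ latticePolytope S) (hv : intVec v ∈ F) :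
    IsUnimodularCone (normalCone (latticePolytope S) F) := by
  obtain ⟨b, hbe⟩ := exists_dual_basis e
  have hb : ∀ i, intVec (b i) ∈ normalCone (latticePolytope S) {intVec v} := fun i => by
    simp only [h.mem_normalCone_iff, intVec_dotProduct_intVec, hbe, e.repr_self,
      Finsupp.single_apply]
    intro j
    split <;> simp
  refine ⟨b, {i | ∀ u ∈ F, intVec (b i) ⬝ᵥ (u - intVec v) = 0}, Set.ext fun w => ?_⟩
  rw [SetLike.mem_coe, mem_hull_basis_iff hbe, mem_normalCone_iff_of_mem hF hv,
    h.mem_normalCone_iff]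
  refine and_congr_right fun hw => ?_
  have hterm : ∀ u ∈ F, ∀ i ∈ Finset.univ,
      0 ≤ (w ⬝ᵥ intVec (e i)) * (intVec (b i) ⬝ᵥ (u - intVec v)) := fun u hu i _ =>
    mul_nonneg (hw i) (by rw [dotProduct_sub, sub_nonneg]; exact hb i _ rfl u (hF hu))
  constructor
  · intro hconst i hi
    simp only [Set.mem_ofPred_eq, not_forall] at hi
    obtain ⟨u, hu, hbu⟩ := hi
    have hsum := hconst u hu
    rw [dotProduct_eq_sum_mul hbe, Finset.sum_eq_zero_iff_of_nonneg (hterm u hu)] at hsum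
    exact (mul_eq_zero.1 (hsum i (Finset.mem_univ i))).resolve_right hbu
  · intro hzero u hu
    rw [dotProduct_eq_sum_mul hbe]
    refine Finset.sum_eq_zero fun i _ => mul_eq_zero.2 ?_
    by_cases hi : ∀ u ∈ F, intVec (b i) ⬝ᵥ (u - intVec v) = 0
    exacts [.inr (hi u hu), .inl (hzero i hi)]

theorem isSmoothPolytope_latticePolytope (hfin : S.Finite)
    (hS : ∀ v ∈ S, ∃ e : Module.Basis (Fin d) ℤ (Fin d → ℤ), IsSmoothVertex S e v) :
    IsSmoothPolytope (latticePolytope S) := by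
  rintro _ ⟨F, hne, hF, rfl⟩
  have hcompact : IsCompact (latticePolytope S) :=
    (hfin.image intVec).isCompact_convexHull ℝ
  obtain ⟨p, hp⟩ := (hF.isCompact hcompact).extremePoints_nonempty hne
  obtain ⟨v, hv, rfl⟩ :=
    extremePoints_convexHull_subset (hF.isExtreme.extremePoints_subset_extremePoints hp)
  obtain ⟨e, he⟩ := hS v hv
  exact he.isUnimodularCone_normalCone hF.subset hp.1

theorem HasSmoothVertices.exists_isSmoothVertex (hS : HasSmoothVertices (Fin d) S)
    (hfin : S.Finite) (hne : S.Nonempty) : ∃ v e, IsSmoothVertex (ι := Fin d) S e v := by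
  -- A point at maximal distance from the origin is a vertex.
  obtain ⟨v, hv, hmax⟩ := hfin.exists_maximalFor (fun x => x ⬝ᵥ x) S hne
  refine ⟨v, hS v hv ⟨dotProductEquiv ℤ _ (-v), fun x hx hxv => ?_⟩⟩
  have hle : x ⬝ᵥ x ≤ v ⬝ᵥ v := not_lt.1 fun hlt => hlt.not_ge (hmax hx hlt.le)
  have hpos : 0 < (x - v) ⬝ᵥ (x - v) :=
    (Finset.sum_nonneg fun i _ => mul_self_nonneg _).lt_of_ne
      fun h => hxv (sub_eq_zero.1 (dotProduct_self_eq_zero.1 h.symm))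
  simp only [dotProductEquiv_apply_apply, sub_dotProduct, dotProduct_sub, neg_dotProduct] at *
  linarith [dotProduct_comm x v]

end LatticePolytopesWithSmoothVertices

section IntegralEquivalence

theorem affineEquiv_image_extremePoints {E F : Type*} [AddCommGroup E] [Module ℝ E]
    [AddCommGroup F] [Module ℝ F] (f : E ≃ᵃ[ℝ] F) (A : Set E) :
    f '' A.extremePoints ℝ = (f '' A).extremePoints ℝ := by
  have hseg : ∀ x y z, z ∈ openSegment ℝ x y ↔ f z ∈ openSegment ℝ (f x) (f y) := fun x y z => by
    rw [← f.coe_toAffineMap, ← image_openSegment ℝ f.toAffineMap x y]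
    exact f.injective.mem_set_image.symm
  ext y
  obtain ⟨x, rfl⟩ := f.surjective y
  simp only [f.injective.mem_set_image, mem_extremePoints_iff_left, Set.forall_mem_image, hseg,
    f.injective.eq_iff]

variable {d : ℕ}

theorem integrallyEquivalent_image (S : Set (Fin d → ℤ))
    (φ : (Fin d → ℤ) ≃ᵃ[ℤ] (Fin d → ℤ)) :
    IntegrallyEquivalent (latticePolytope S) (latticePolytope (φ '' S)) := by
  let f := (realExtensionEquiv φ.linear).toAffineEquiv.trans
    (AffineEquiv.constVAdd ℝ (Fin d → ℝ) (intVec (φ 0)))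
  have hf : ∀ x, f (intVec x) = intVec (φ x) := fun x => by
    change intVec (φ 0) + realExtensionEquiv φ.linear (intVec x) = _
    rw [realExtensionEquiv_intVec, ← intVec_add, ← affineEquiv_add, zero_add]
  refine ⟨f, ?_, ?_⟩
  · rw [latticeSet, ← Set.range_comp, ← φ.surjective.range_comp intVec]
    exact congrArg Set.range (funext hf)
  · rw [latticePolytope, ← f.coe_toAffineMap, f.toAffineMap.image_convexHull, Set.image_image,
      latticePolytope, Set.image_image]
    simp only [AffineEquiv.coe_toAffineMap, hf]

theorem exists_affineEquiv_of_image_latticeSet {f : (Fin d → ℝ) ≃ᵃ[ℝ] (Fin d → ℝ)}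
    (hf : f '' latticeSet d = latticeSet d) :
    ∃ φ : (Fin d → ℤ) ≃ᵃ[ℤ] (Fin d → ℤ), ∀ x, f (intVec x) = intVec (φ x) := by
  have hint : ∀ x : Fin d → ℤ, ∃ y, intVec y = f (intVec x) := fun x =>
    hf.le ⟨_, ⟨x, rfl⟩, rfl⟩
  choose g hg using hint
  have hbij : Function.Bijective g := by
    refine ⟨fun x y hxy => intVec_injective (f.injective ?_), fun y => ?_⟩
    · rw [← hg, ← hg, hxy]
    · obtain ⟨_, ⟨x, rfl⟩, hx⟩ := hf.ge ⟨y, rfl⟩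
      exact ⟨x, intVec_injective ((hg x).trans hx)⟩
  have hadd : ∀ x y, g (x + y) = g x + (g y - g 0) := fun x y => intVec_injective <| by
    have hlin : f (intVec x + intVec y) = f.linear (intVec x) + f (intVec y) :=
      f.map_vadd (intVec y) (intVec x)
    have hlin' : f (intVec x) = f.linear (intVec x) + f 0 := by
      simpa using f.map_vadd 0 (intVec x)
    rw [intVec_add, intVec_sub, hg, hg, hg, hg, intVec_add, intVec_zero, hlin, hlin']
    abel
  let φ : (Fin d → ℤ) →ᵃ[ℤ] (Fin d → ℤ) :=
    { toFun := g
      linear := (AddMonoidHom.mk' (fun x => g x - g 0) fun x y => by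
        rw [hadd, add_sub_right_comm]).toIntLinearMap
      map_vadd' := fun x y => by
        rw [vadd_eq_add, add_comm, hadd, add_comm]
        rfl }
  exact ⟨.ofBijective (φ := φ) hbij, fun x => (hg x).symm⟩

theorem IntegrallyEquivalent.exists_image_eq {S T : Set (Fin d → ℤ)}
    (h : IntegrallyEquivalent (latticePolytope S) (latticePolytope T))
    (hS : (latticePolytope S).extremePoints ℝ = intVec '' S)
    (hT : (latticePolytope T).extremePoints ℝ = intVec '' T) :
    ∃ φ : (Fin d → ℤ) ≃ᵃ[ℤ] (Fin d → ℤ), φ '' S = T := by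
  obtain ⟨f, hlattice, hpolytope⟩ := h
  obtain ⟨φ, hφ⟩ := exists_affineEquiv_of_image_latticeSet hlattice
  refine ⟨φ, intVec_injective.image_injective ?_⟩
  rw [← hT, ← hpolytope, ← affineEquiv_image_extremePoints, hS]
  simp only [Set.image_image, hφ]

end IntegralEquivalence

section Det

/-- The determinant of two vectors of `ℤ²`. -/
def det2 (u x : ℤ × ℤ) : ℤ := u.1 * x.2 - u.2 * x.1

theorem det2_self (u : ℤ × ℤ) : det2 u u = 0 := by
  simp only [det2]
  ring

theorem det2_neg_left (u x : ℤ × ℤ) : det2 (-u) x = -det2 u x := by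
  simp only [det2, Prod.fst_neg, Prod.snd_neg]
  ring

theorem det2_add (u x y : ℤ × ℤ) : det2 u (x + y) = det2 u x + det2 u y := by
  simp only [det2, Prod.fst_add, Prod.snd_add]
  ring

theorem det2_smul (u : ℤ × ℤ) (n : ℤ) (x : ℤ × ℤ) : det2 u (n • x) = n * det2 u x := by
  simp only [det2, Prod.smul_fst, Prod.smul_snd, smul_eq_mul]
  ring

theorem det2_nsmul (u : ℤ × ℤ) (n : ℕ) (x : ℤ × ℤ) : det2 u (n • x) = n * det2 u x := by
  rw [← natCast_zsmul, det2_smul]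

theorem det2_sub (u x y : ℤ × ℤ) : det2 u (x - y) = det2 u x - det2 u y := by
  simp only [det2, Prod.fst_sub, Prod.snd_sub]
  ring

theorem det2_neg_right (u x : ℤ × ℤ) : det2 u (-x) = -det2 u x := by
  simp only [det2, Prod.fst_neg, Prod.snd_neg]
  ring

theorem det2_swap (u x : ℤ × ℤ) : det2 x u = -det2 u x := by
  simp only [det2]
  ring

theorem det2_smul_eq (u w x : ℤ × ℤ) : det2 u w • x = det2 u x • w - det2 w x • u := by
  ext <;> simp only [det2, Prod.smul_fst, Prod.smul_snd, Prod.fst_sub, Prod.snd_sub,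
    smul_eq_mul] <;> ring

theorem eq_add_smul_sub_smul {u w : ℤ × ℤ} (h : det2 u w = 1) (x y : ℤ × ℤ) :
    x = y + det2 u (x - y) • w - det2 w (x - y) • u := by
  rw [add_sub_assoc, ← det2_smul_eq, h, one_smul, add_sub_cancel]

/-- The map `x ↦ det2 u x`, which up to sign is the oriented distance to the line spanned by `u`. -/
def det2Linear (u : ℤ × ℤ) : (ℤ × ℤ) →ₗ[ℤ] ℤ where
  toFun := det2 u
  map_add' := det2_add u
  map_smul' := det2_smul u

/-- The linear automorphism of `ℤ²` that maps `w` to `(1, 0)` and `-u` to `(0, 1)`. -/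
def frameEquiv {u w : ℤ × ℤ} (h : det2 u w = 1) : (ℤ × ℤ) ≃ₗ[ℤ] ℤ × ℤ where
  toLinearMap := (det2Linear u).prod (det2Linear w)
  invFun y := y.1 • w - y.2 • u
  left_inv x := by
    change det2 u x • w - det2 w x • u = x
    rw [← det2_smul_eq, h, one_smul]
  right_inv y := by
    change (det2 u (y.1 • w - y.2 • u), det2 w (y.1 • w - y.2 • u)) = y
    rw [det2_sub, det2_sub, det2_smul, det2_smul, det2_smul, det2_smul, det2_self, det2_self,
      det2_swap u w, h]
    simp

/-- The basis `w, -u` of `ℤ²`: the directions of the two edges at a vertex of a polygon whose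
boundary, traversed counterclockwise, enters this vertex in direction `u` and leaves it in
direction `w`. -/
noncomputable def cornerBasis {u w : ℤ × ℤ} (h : det2 u w = 1) : Module.Basis (Fin 2) ℤ (ℤ × ℤ) :=
  .ofEquivFun ((frameEquiv h).trans (LinearEquiv.finTwoArrow ℤ ℤ).symm)

variable {u w : ℤ × ℤ} (h : det2 u w = 1)

theorem cornerBasis_zero : cornerBasis h 0 = w := by
  simp [cornerBasis, frameEquiv]

theorem cornerBasis_one : cornerBasis h 1 = -u := by
  simp [cornerBasis, frameEquiv]

theorem cornerBasis_repr_zero (x : ℤ × ℤ) : (cornerBasis h).repr x 0 = det2 u x := rfl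

theorem cornerBasis_repr_one (x : ℤ × ℤ) : (cornerBasis h).repr x 1 = det2 w x := rfl

theorem det2_basis_eq_one_or (e : Module.Basis (Fin 2) ℤ (ℤ × ℤ)) :
    det2 (e 0) (e 1) = 1 ∨ det2 (e 0) (e 1) = -1 := by
  have hexpand : ∀ x y, det2 x y =
      det2 (e 0) (e 1) * (e.repr x 0 * e.repr y 1 - e.repr x 1 * e.repr y 0) := fun x y => by
    conv_lhs => rw [← e.sum_repr x, ← e.sum_repr y]
    simp only [Fin.sum_univ_two, det2, Prod.smul_fst, Prod.smul_snd, Prod.fst_add, Prod.snd_add,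
      smul_eq_mul]
    ring
  exact Int.eq_one_or_neg_one_of_mul_eq_one (hexpand (1, 0) (0, 1)).symm

theorem IsSmoothVertex.exists_cornerBasis {S : Set (ℤ × ℤ)}
    {e : Module.Basis (Fin 2) ℤ (ℤ × ℤ)} {v : ℤ × ℤ} (hv : IsSmoothVertex S e v) :
    ∃ (u w : ℤ × ℤ) (h : det2 u w = 1), IsSmoothVertex S (cornerBasis h) v := by
  rcases det2_basis_eq_one_or e with hdet | hdet
  · have h : det2 (-e 1) (e 0) = 1 := by rw [det2_neg_left, det2_swap, neg_neg, hdet]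
    have he : cornerBasis h = e := Module.Basis.eq_of_apply_eq fun i => by
      fin_cases i <;> simp [cornerBasis_zero, cornerBasis_one]
    exact ⟨_, _, h, by rwa [he]⟩
  · have h : det2 (-e 0) (e 1) = 1 := by rw [det2_neg_left, hdet, neg_neg]
    have he : cornerBasis h = e.reindex (Equiv.swap 0 1) := Module.Basis.eq_of_apply_eq fun i => by
      fin_cases i <;> simp [cornerBasis_zero, cornerBasis_one]
    exact ⟨_, _, h, by rw [he]; exact hv.reindex _⟩

end Det

section Turns

variable {S : Set (ℤ × ℤ)} {u v : ℤ × ℤ}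

/-- The set `S` lies to the left of the ray that starts at the point `v` of `S` in direction `u`. -/
structure IsBoundaryRay (S : Set (ℤ × ℤ)) (v u : ℤ × ℤ) : Prop where
  mem : v ∈ S
  nonneg : ∀ x ∈ S, 0 ≤ det2 u (x - v)

theorem exists_last_add_nsmul_mem (hfin : S.Finite) (hseg : IsSegmentClosed S) (hv : v ∈ S)
    (hu : u ≠ 0) :
    ∃ l : ℕ, (∀ i ≤ l, v + i • u ∈ S) ∧ ∀ i : ℕ, v + i • u ∈ S → i ≤ l := by
  have hinj : Function.Injective fun i : ℕ => v + i • u := by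
    simp only [← natCast_zsmul]
    exact (add_right_injective v).comp ((smul_left_injective ℤ hu).comp Nat.cast_injective)
  obtain ⟨l, hl, hmax⟩ := (hfin.preimage hinj.injOn).exists_maximal ⟨0, by simpa using hv⟩
  exact ⟨l, fun i hi => hseg hv hl hi, fun i hi => not_lt.1 fun hlt => hlt.not_ge (hmax hi hlt.le)⟩

theorem exists_eq_sub_nsmul_of_last {w : ℤ × ℤ} {l : ℕ} (huw : det2 u w = 1)
    (hmax : ∀ i : ℕ, v + i • w ∈ S → i ≤ l) {x : ℤ × ℤ} (hx : x ∈ S)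
    (hzero : det2 w (x - (v + l • w)) = 0) : ∃ k : ℕ, x = v + l • w - k • w := by
  have hx' := eq_add_smul_sub_smul huw x (v + l • w)
  rw [hzero, zero_smul, sub_zero] at hx'
  rcases le_total 0 (det2 u (x - (v + l • w))) with hc | hc
  · obtain ⟨c, hc⟩ := Int.eq_ofNat_of_zero_le hc
    rw [hc, natCast_zsmul, add_assoc, ← add_smul] at hx'
    have hle : l + c ≤ l := hmax _ (hx' ▸ hx)
    exact ⟨0, by rw [hx', show c = 0 by omega, add_zero, zero_smul, sub_zero]⟩
  · obtain ⟨c, hc⟩ := Int.exists_eq_neg_ofNat hc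
    exact ⟨c, by rw [hx', hc, neg_smul, natCast_zsmul, ← sub_eq_add_neg]⟩

theorem IsBoundaryRay.exists_det2_pos (h : IsBoundaryRay S v u) (hfin : S.Finite) (hu : u ≠ 0)
    (hlast : ∀ x ∈ S, det2 u (x - v) = 0 → ∃ k : ℕ, x = v - k • u) :
    ∃ a, ∀ x ∈ S, x ≠ v → 0 < det2 a (x - v) := by
  let r : ℤ × ℤ := (-u.2, u.1)
  have hr : 0 < det2 r (-u) := by
    have : 0 < u.1 ^ 2 ∨ 0 < u.2 ^ 2 := by
      simp only [sq_pos_iff]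
      by_contra! h0
      exact hu (Prod.ext h0.1 h0.2)
    simp only [r, det2, Prod.fst_neg, Prod.snd_neg]
    rcases this with h | h <;> nlinarith [sq_nonneg u.1, sq_nonneg u.2]
  obtain ⟨n, hn⟩ := exists_forall_pos_mul_add (hfin.subset Set.sdiff_subset)
    (g := fun x => det2 u (x - v)) (h := fun x => det2 r (x - v)) fun x (hx : x ∈ S \ {v}) => by
      refine (h.nonneg x hx.1).lt_or_eq.imp_right fun hzero => ⟨hzero.symm, ?_⟩
      obtain ⟨k, rfl⟩ := hlast x hx.1 hzero.symm
      have hk : 0 < k := Nat.pos_of_ne_zero fun hk => hx.2 (by simp [hk])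
      rw [sub_sub_cancel_left, ← smul_neg, det2_nsmul]
      positivity
  refine ⟨(n : ℤ) • u + r, fun x hx hxv => (hn x ⟨hx, hxv⟩).trans_eq ?_⟩
  simp only [det2, Prod.fst_add, Prod.snd_add, Prod.smul_fst, Prod.smul_snd, smul_eq_mul]
  ring

theorem IsBoundaryRay.exists_turn (h : IsBoundaryRay S v u) (hS : HasSmoothVertices (Fin 2) S)
    (hfin : S.Finite) (hseg : IsSegmentClosed S) {y : ℤ × ℤ} (hy : det2 u y = 1)
    (hprev : v - u ∈ S) (hlast : ∀ x ∈ S, det2 u (x - v) = 0 → ∃ k : ℕ, x = v - k • u) :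
    ∃ w, det2 u w = 1 ∧ IsBoundaryRay S v w ∧ v + w ∈ S := by
  obtain ⟨a, ha⟩ := h.exists_det2_pos hfin (by rintro rfl; simp [det2] at hy) hlast
  obtain ⟨e, he⟩ := hS v h.mem ⟨det2Linear a, ha⟩
  obtain ⟨u', w, huw, hcorner⟩ := he.exists_cornerBasis
  have hw_mem : v + w ∈ S := by simpa only [cornerBasis_zero] using hcorner.add_mem hseg 0
  have hu'_mem : v - u' ∈ S := by
    simpa only [cornerBasis_one, ← sub_eq_add_neg] using hcorner.add_mem hseg 1
  -- `-u` lies in the cone spanned by `w` and `-u'`, and `-u'` lies to the left of `u`.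
  have hnonneg_w : 0 ≤ det2 w (-u) := by
    simpa only [cornerBasis_repr_one, sub_sub_cancel_left] using
      hcorner.repr_sub_nonneg _ hprev 1
  have hnonneg_u' : 0 ≤ det2 u' (-u) := by
    simpa only [cornerBasis_repr_zero, sub_sub_cancel_left] using
      hcorner.repr_sub_nonneg _ hprev 0
  have hnonneg_u : 0 ≤ det2 u (-u') := by simpa using h.nonneg _ hu'_mem
  have hparallel : u = (-det2 w u) • u' := by
    have : det2 u' u = 0 := by
      rw [det2_neg_right] at hnonneg_u' hnonneg_u
      linarith [det2_swap u u']
    simpa [huw, this] using det2_smul_eq u' w u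
  have hunit : -det2 w u = 1 := by
    rw [det2_neg_right] at hnonneg_w
    refine Int.eq_one_of_mul_eq_one_right hnonneg_w (b := det2 u' y) ?_
    rw [← hy, det2_swap y u, det2_swap y u', mul_neg, ← det2_smul, ← hparallel]
  rw [hunit, one_smul] at hparallel
  subst hparallel
  exact ⟨w, huw, ⟨h.mem, fun x hx => hcorner.repr_sub_nonneg x hx 1⟩, hw_mem⟩

end Turns

section PlanarPolygons

/-- The identification of `ℤ²`, whose points are encoded as pairs for computations, with
`Fin 2 → ℤ`. -/
def ofPair : (ℤ × ℤ) ≃ₗ[ℤ] (Fin 2 → ℤ) := (LinearEquiv.finTwoArrow ℤ ℤ).symm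

/-- The convex hull in `ℝ²` of a set of lattice points that are given as pairs. -/
def planarPolygon (V : Set (ℤ × ℤ)) : Set (Fin 2 → ℝ) := latticePolytope (ofPair '' V)

/-- The lattice points in the convex hull of a set of lattice points, as pairs. -/
def latticeHull (V : Set (ℤ × ℤ)) : Set (ℤ × ℤ) := ofPair ⁻¹' latticePoints (planarPolygon V)

variable {V W : Set (ℤ × ℤ)}

theorem subset_latticeHull (V : Set (ℤ × ℤ)) : V ⊆ latticeHull V :=
  Set.image_subset_iff.1 (subset_latticePoints_latticePolytope _)

theorem latticeHull_mono (h : V ⊆ W) : latticeHull V ⊆ latticeHull W :=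
  Set.preimage_mono (Set.preimage_mono (convexHull_mono (Set.image_mono (Set.image_mono h))))

theorem mem_latticeHull_of_smul_eq {x y z : ℤ × ℤ} (hy : y ∈ V) (hz : z ∈ V) (h0 : 0 ∈ V)
    {n a b : ℤ} (hn : 0 < n) (ha : 0 ≤ a) (hb : 0 ≤ b) (hab : a + b ≤ n)
    (hx : n • x = a • y + b • z) : x ∈ latticeHull V := by
  refine mem_latticePoints_of_smul_eq (convex_convexHull ℝ _) (subset_latticeHull V hy)
    (subset_latticeHull V hz) ?_ hn ha hb hab ?_
  · rw [← map_zero ofPair]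
    exact subset_latticeHull V h0
  · simp only [← map_smul, ← map_add, hx]

theorem planarPolygon_eq_of_subset (hVW : V ⊆ W) (hWV : W ⊆ latticeHull V) :
    planarPolygon V = planarPolygon W :=
  latticePolytope_eq_of_subset (Set.image_mono hVW) (Set.image_subset_iff.2 hWV)

theorem det2_nonneg_of_mem_latticeHull {u v : ℤ × ℤ} (hV : ∀ y ∈ V, 0 ≤ det2 u (y - v))
    {x : ℤ × ℤ} (hx : x ∈ latticeHull V) : 0 ≤ det2 u (x - v) := by
  have hdot : ∀ y, intVec (ofPair (-u.2, u.1)) ⬝ᵥ intVec (ofPair y - ofPair v) =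
      det2 u (y - v) := fun y => by
    rw [intVec_dotProduct_intVec]
    simp [ofPair, det2, Fin.sum_univ_two, dotProduct]
    ring
  have hcone : intVec (ofPair (-u.2, u.1)) ∈ normalCone (planarPolygon V) {intVec (ofPair v)} := by
    refine mem_normalCone_singleton_iff.2 ?_
    rintro _ ⟨y, hy, rfl⟩
    rw [hdot]
    exact_mod_cast hV y hy
  have := hcone _ rfl _ hx
  rw [← sub_nonneg, ← dotProduct_sub, ← intVec_sub, hdot] at this
  exact_mod_cast this

theorem exists_isSmoothVertex_image_ofPair
    (hV : ∀ v ∈ V, ∃ e : Module.Basis (Fin 2) ℤ (ℤ × ℤ), IsSmoothVertex V e v) :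
    ∀ v ∈ ofPair '' V, ∃ e : Module.Basis (Fin 2) ℤ (Fin 2 → ℤ),
      IsSmoothVertex (ofPair '' V) e v := by
  rintro _ ⟨v, hv, rfl⟩
  obtain ⟨e, he⟩ := hV v hv
  exact ⟨_, he.image ofPair.toAffineEquiv⟩

theorem isLatticePolytope_planarPolygon (hfin : V.Finite) (hne : V.Nonempty)
    (hV : ∀ v ∈ V, ∃ e : Module.Basis (Fin 2) ℤ (ℤ × ℤ), IsSmoothVertex V e v) :
    IsLatticePolytope (planarPolygon V) := by
  obtain ⟨v, hv⟩ := hne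
  obtain ⟨e, he⟩ := exists_isSmoothVertex_image_ofPair hV (ofPair v) (Set.mem_image_of_mem _ hv)
  refine ⟨⟨(hfin.image ofPair).toFinset, ?_⟩, he.affineSpan_eq_top⟩
  rw [Set.Finite.coe_toFinset]
  rfl

theorem isSmoothPolytope_planarPolygon (hfin : V.Finite)
    (hV : ∀ v ∈ V, ∃ e : Module.Basis (Fin 2) ℤ (ℤ × ℤ), IsSmoothVertex V e v) :
    IsSmoothPolytope (planarPolygon V) :=
  isSmoothPolytope_latticePolytope (hfin.image _) (exists_isSmoothVertex_image_ofPair hV)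

theorem extremePoints_planarPolygon
    (hV : ∀ v ∈ V, ∃ e : Module.Basis (Fin 2) ℤ (ℤ × ℤ), IsSmoothVertex V e v) :
    (planarPolygon V).extremePoints ℝ = intVec '' (ofPair '' V) :=
  extremePoints_latticePolytope (exists_isSmoothVertex_image_ofPair hV)

theorem integrallyEquivalent_planarPolygon (φ : (Fin 2 → ℤ) ≃ᵃ[ℤ] ℤ × ℤ) (L : Set (Fin 2 → ℤ)) :
    IntegrallyEquivalent (latticePolytope L) (planarPolygon (φ '' L)) := by
  rw [planarPolygon, Set.image_image]
  exact integrallyEquivalent_image L (φ.trans ofPair.toAffineEquiv)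

theorem integrallyEquivalent_planarPolygon_image (φ : (ℤ × ℤ) ≃ᵃ[ℤ] ℤ × ℤ) (V : Set (ℤ × ℤ)) :
    IntegrallyEquivalent (planarPolygon V) (planarPolygon (φ '' V)) := by
  have := integrallyEquivalent_planarPolygon (ofPair.symm.toAffineEquiv.trans φ) (ofPair '' V)
  rw [Set.image_image] at this
  simpa [planarPolygon] using this

theorem exists_image_eq_of_integrallyEquivalent_planarPolygon
    (hV : ∀ v ∈ V, ∃ e : Module.Basis (Fin 2) ℤ (ℤ × ℤ), IsSmoothVertex V e v)
    (hW : ∀ v ∈ W, ∃ e : Module.Basis (Fin 2) ℤ (ℤ × ℤ), IsSmoothVertex W e v)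
    (h : IntegrallyEquivalent (planarPolygon V) (planarPolygon W)) :
    ∃ φ : (ℤ × ℤ) ≃ᵃ[ℤ] ℤ × ℤ, φ '' V = W := by
  obtain ⟨φ, hφ⟩ :=
    h.exists_image_eq (extremePoints_planarPolygon hV) (extremePoints_planarPolygon hW)
  refine ⟨(ofPair.toAffineEquiv.trans φ).trans ofPair.symm.toAffineEquiv,
    ofPair.injective.image_injective ?_⟩
  rw [← hφ, Set.image_image, Set.image_image]
  exact Set.image_congr fun x _ => ofPair.apply_symm_apply _

end PlanarPolygons

section Walks

variable {S : Set (ℤ × ℤ)} {H : List ((ℤ × ℤ) × ℤ × ℤ)} {u v z : ℤ × ℤ}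

/-- The state of a counterclockwise walk along the boundary of `S` that starts at the vertex `0`
and has arrived at the vertex `v` in direction `u`. The list `H` consists of the boundary rays
found before, and `z` is the first point of `S` on the line at lattice distance one from the
current edge. -/
structure IsPartialWalk (S : Set (ℤ × ℤ)) (H : List ((ℤ × ℤ) × ℤ × ℤ)) (v u z : ℤ × ℤ) :
    Prop where
  ray : IsBoundaryRay S v u
  rays : ∀ h ∈ H, IsBoundaryRay S h.1 h.2
  zero_mem : 0 ∈ H.map Prod.fst
  sub_mem : v - u ∈ S
  eq_sub_nsmul : ∀ x ∈ S, det2 u (x - v) = 0 → ∃ k : ℕ, x = v - k • u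
  next_mem : z ∈ S
  det2_next : det2 u (z - v) = 1
  eq_next_add_nsmul : ∀ x ∈ S, det2 u (x - v) = 1 → ∃ m : ℕ, x = z + m • u
  swept : ∀ x ∈ S, 0 ≤ det2 x v → x ∈ latticeHull {y | y ∈ v :: H.map Prod.fst}

theorem IsPartialWalk.swept_next {w v' : ℤ × ℤ} {l : ℕ} (h : IsPartialWalk S H v u z)
    (hw : IsBoundaryRay S v w) (hv' : v' = v + l • w) :
    ∀ x ∈ S, 0 ≤ det2 x v' → x ∈ latticeHull {y | y ∈ v' :: v :: H.map Prod.fst} := by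
  intro x hx hxv'
  by_cases hxv : 0 ≤ det2 x v
  · exact latticeHull_mono (fun y hy => List.mem_cons_of_mem _ hy) (h.swept x hx hxv)
  -- Otherwise `x` lies in the triangle with vertices `0`, `v` and `v'`.
  have hvx : 0 < det2 v x := by rw [det2_swap]; omega
  have hleft : 0 ≤ l * det2 w (x - v) := mul_nonneg (Nat.cast_nonneg l) (hw.nonneg x hx)
  have harea : det2 v x + det2 x v' ≤ det2 v v' := by
    have : det2 v v' - (det2 v x + det2 x v') = l * det2 w (x - v) := by
      simp only [hv', ← natCast_zsmul, det2, Prod.fst_add, Prod.snd_add, Prod.smul_fst,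
        Prod.smul_snd, Prod.fst_sub, Prod.snd_sub, smul_eq_mul]
      ring
    linarith
  refine mem_latticeHull_of_smul_eq (y := v') (z := v) (n := det2 v v') (by simp) (by simp)
    (List.mem_cons_of_mem _ (List.mem_cons_of_mem _ h.zero_mem)) (by linarith) hvx.le hxv' harea ?_
  rw [det2_smul_eq, det2_swap v' x, neg_smul, ← sub_eq_add_neg]

theorem IsPartialWalk.exists_next (h : IsPartialWalk S H v u z)
    (hS : HasSmoothVertices (Fin 2) S) (hfin : S.Finite) (hseg : IsSegmentClosed S) :
    ∃ (w : ℤ × ℤ) (m l : ℕ), v + w = z + m • u ∧ (∀ i ≤ m, z + i • u ∈ S) ∧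
      (∀ i ≤ l, v + w + i • w ∈ S) ∧ IsBoundaryRay S v w ∧
      IsPartialWalk S ((v, w) :: H) (v + w + l • w) w (v - u) := by
  obtain ⟨w, huw, hray, hmem⟩ :=
    h.ray.exists_turn hS hfin hseg h.det2_next h.sub_mem h.eq_sub_nsmul
  obtain ⟨m, hm⟩ := h.eq_next_add_nsmul _ hmem (by rwa [add_sub_cancel_left])
  obtain ⟨l, hl, hmax⟩ := exists_last_add_nsmul_mem hfin hseg hmem (u := w)
    (by rintro rfl; simp [det2] at huw)
  have hv' : v + w + l • w = v + (l + 1) • w := by rw [add_smul, one_smul]; abel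
  have hww : ∀ x, det2 w (x - (v + w + l • w)) = det2 w (x - v) := fun x => by
    rw [hv', sub_add_eq_sub_sub, det2_sub, det2_nsmul, det2_self, mul_zero, sub_zero]
  refine ⟨w, m, l, hm, fun i hi => hseg h.next_mem (hm ▸ hmem) hi, hl, hray, ?_⟩
  refine ⟨⟨hl l le_rfl, fun x hx => (hww x).symm ▸ hray.nonneg x hx⟩,
    List.forall_mem_cons.2 ⟨hray, h.rays⟩, List.mem_cons_of_mem _ h.zero_mem, ?_,
    fun x => exists_eq_sub_nsmul_of_last huw hmax, h.sub_mem, ?_, ?_, h.swept_next hray hv'⟩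
  · rw [hv', add_smul, one_smul, ← add_assoc, add_sub_cancel_right]
    exact hseg hray.mem (hv' ▸ hl l le_rfl) (Nat.le_succ l)
  · rw [hww, sub_sub_cancel_left, det2_neg_right, det2_swap, huw, neg_neg]
  · intro x hx hone
    rw [hww] at hone
    have hx' := eq_add_smul_sub_smul huw x v
    obtain ⟨c, hc⟩ := Int.eq_ofNat_of_zero_le (h.ray.nonneg x hx)
    rw [hone, hc, one_smul, natCast_zsmul, add_sub_right_comm] at hx'
    exact ⟨c, hx'⟩

end Walks

section Search

/-- `forceInt n k` is `k n`, with `n` brought to normal form before `k` is applied. -/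
def forceInt {α : Type*} (n : ℤ) (k : ℤ → α) : α :=
  match n with
  | .ofNat 0 => k 0
  | .ofNat (n + 1) => k (.ofNat (n + 1))
  | .negSucc 0 => k (-1)
  | .negSucc (n + 1) => k (.negSucc (n + 1))

/-- `forcePoint p k` is `k p`, with `p` brought to normal form before `k` is applied. In the search
below it keeps the kernel from evaluating the coordinates of a point anew at each occurrence. -/
def forcePoint {α : Type*} (p : ℤ × ℤ) (k : ℤ × ℤ → α) : α :=
  forceInt p.1 fun a => forceInt p.2 fun b => k (a, b)

theorem forceInt_eq {α : Type*} (n : ℤ) (k : ℤ → α) : forceInt n k = k n := by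
  rcases n with (_ | n) | (_ | n) <;> rfl

theorem forcePoint_eq {α : Type*} (p : ℤ × ℤ) (k : ℤ × ℤ → α) : forcePoint p k = k p := by
  rw [forcePoint, forceInt_eq, forceInt_eq]

/-- Checks `k` at the points `p`, `p + u`, `p + 2 • u`, …. These points are added to the list `K`
of known lattice points, and the check ends as soon as there are more than `N` of them. The
natural number before `p` bounds the number of steps. -/
def allAlong (N : ℕ) (u : ℤ × ℤ) (k : ℤ × ℤ → List (ℤ × ℤ) → Bool) :
    ℕ → ℤ × ℤ → List (ℤ × ℤ) → Bool
  | 0, _, _ => false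
  | n + 1, p, K => forcePoint p fun p =>
      decide (N < (K.insert p).length) ||
        (k p (K.insert p) && allAlong N u k n (p + u) (K.insert p))

/-- Checks `accept` on the vertex list of every smooth polygon with at most `N` lattice points
whose boundary walk continues the one given by `H`, `v`, `u`, `z` (see `IsPartialWalk`) and that
contains the lattice points in `K`. The point `q` runs over the candidates for `v + w`, where `w`
is the direction of the next edge, and `v'` over those for the next vertex. -/
def allWalks (N : ℕ) (accept : List (ℤ × ℤ) → Bool) :
    ℕ → List ((ℤ × ℤ) × ℤ × ℤ) → List (ℤ × ℤ) → ℤ × ℤ → ℤ × ℤ → ℤ × ℤ → Bool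
  | 0, _, _, _, _, _ => false
  | n + 1, H, K, v, u, z =>
    allAlong N u (fun q K => forcePoint (q - v) fun w =>
      !(H.all fun h => 0 ≤ det2 h.2 (q - h.1)) || !(K.all fun x => 0 ≤ det2 w (x - v)) ||
        allAlong N w (fun v' K =>
          !(H.all fun h => 0 ≤ det2 h.2 (v' - h.1)) ||
            if v' = 0 then accept (v :: H.map Prod.fst)
            else allWalks N accept n ((v, w) :: H) K v' w (v - u)) (N + 1) q K) (N + 1) z K

/-- Checks `accept` on the vertex list of every smooth polygon with at most `N` lattice points
that lies in the positive quadrant and has edges starting at `0` along both coordinate axes. -/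
def allPolygons (N : ℕ) (accept : List (ℤ × ℤ) → Bool) : Bool :=
  allAlong N (1, 0) (fun v K => allWalks N accept (N + 1) [(0, (0, -1)), (0, (1, 0))] K v (1, 0)
    (0, 1)) (N + 1) (1, 0) [(0, 1), (0, 0)]

/-- `K` lists points of `S`, without repetitions. -/
structure IsListOfPoints (S : Set (ℤ × ℤ)) (K : List (ℤ × ℤ)) : Prop where
  nodup : K.Nodup
  mem : ∀ x ∈ K, x ∈ S

variable {S : Set (ℤ × ℤ)} {N n l : ℕ} {K : List (ℤ × ℤ)}

theorem IsListOfPoints.insert (hK : IsListOfPoints S K) {p : ℤ × ℤ} (hp : p ∈ S) :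
    IsListOfPoints S (K.insert p) where
  nodup := hK.nodup.insert
  mem x hx := by
    rcases List.mem_insert_iff.1 hx with rfl | hx
    exacts [hp, hK.mem x hx]

theorem IsListOfPoints.length_le (hK : IsListOfPoints S K) (hS : S.encard ≤ N) : K.length ≤ N := by
  rw [← List.toFinset_card_of_nodup hK.nodup, ← Nat.cast_le (α := ℕ∞),
    ← Set.encard_coe_eq_coe_finsetCard]
  exact (Set.encard_le_encard fun x hx => hK.mem x (by simpa using hx)).trans hS

theorem IsListOfPoints.exists_of_allAlong {k : ℤ × ℤ → List (ℤ × ℤ) → Bool} {p u : ℤ × ℤ}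
    (hK : IsListOfPoints S K) (hS : S.encard ≤ N) (hk : allAlong N u k n p K = true)
    (hp : ∀ i ≤ l, p + i • u ∈ S) : ∃ K', IsListOfPoints S K' ∧ k (p + l • u) K' = true := by
  induction n generalizing p K l with
  | zero => simp [allAlong] at hk
  | succ n ih =>
    have hinsert := hK.insert (by simpa using hp 0 l.zero_le)
    simp only [allAlong, forcePoint_eq, Bool.or_eq_true, decide_eq_true_eq, Bool.and_eq_true,
      (hinsert.length_le hS).not_gt, false_or] at hk
    cases l with
    | zero => exact ⟨_, hinsert, by simpa using hk.1⟩
    | succ l =>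
      have hshift : ∀ i : ℕ, p + u + i • u = p + (i + 1) • u := fun i => by
        rw [add_smul, one_smul, add_assoc, add_comm u]
      rw [← hshift]
      exact ih hinsert hk.2 fun i hi => hshift i ▸ hp (i + 1) (by omega)

theorem IsPartialWalk.exists_accept {H : List ((ℤ × ℤ) × ℤ × ℤ)} {v u z : ℤ × ℤ}
    {accept : List (ℤ × ℤ) → Bool} (h : IsPartialWalk S H v u z)
    (hsmooth : HasSmoothVertices (Fin 2) S) (hseg : IsSegmentClosed S) (hS : S.encard ≤ N)
    (hK : IsListOfPoints S K) (hwalks : allWalks N accept n H K v u z = true) :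
    ∃ V, accept V = true ∧ (∀ x ∈ V, x ∈ S) ∧ S ⊆ latticeHull {x | x ∈ V} := by
  induction n generalizing H K v u z with
  | zero => simp [allWalks] at hwalks
  | succ n ih =>
    obtain ⟨w, m, l, hq, hrow, hedge, hray, hnext⟩ :=
      h.exists_next hsmooth (Set.finite_of_encard_le_coe hS) hseg
    have hrays : ∀ x ∈ S, (H.all fun h => 0 ≤ det2 h.2 (x - h.1)) = true := fun x hx =>
      List.all_eq_true.2 fun r hr => decide_eq_true ((h.rays r hr).nonneg x hx)
    obtain ⟨K', hK', hcheck⟩ := hK.exists_of_allAlong hS hwalks hrow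
    have hleft : (K'.all fun x => 0 ≤ det2 w (x - v)) = true :=
      List.all_eq_true.2 fun x hx => decide_eq_true (hray.nonneg x (hK'.mem x hx))
    rw [← hq, forcePoint_eq, add_sub_cancel_left, hleft, hrays _ (by simpa using hedge 0 l.zero_le)]
      at hcheck
    obtain ⟨K'', hK'', hcheck'⟩ := hK'.exists_of_allAlong hS hcheck hedge
    rw [hrays _ (hedge l le_rfl), Bool.not_true, Bool.false_or] at hcheck'
    split_ifs at hcheck' with hzero
    · rw [hzero] at hnext
      refine ⟨_, hcheck', fun x hx => ?_, fun x hx => latticeHull_mono (fun y hy => ?_)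
        (hnext.swept x hx (by simp [det2]))⟩
      · obtain ⟨r, hr, rfl⟩ := List.mem_map.1 (show x ∈ ((v, w) :: H).map Prod.fst from hx)
        exact (hnext.rays r hr).mem
      · rcases List.mem_cons.1 hy with rfl | hy
        exacts [hnext.zero_mem, hy]
    · exact ih hnext hK'' hcheck'

theorem exists_isPartialWalk_start (hfin : S.Finite) (hseg : IsSegmentClosed S)
    (hquad : ∀ x ∈ S, 0 ≤ x.1 ∧ 0 ≤ x.2) (h0 : 0 ∈ S) (h10 : (1, 0) ∈ S) (h01 : (0, 1) ∈ S) :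
    ∃ l : ℕ, (∀ i ≤ l, (1, 0) + i • (1, 0) ∈ S) ∧
      IsPartialWalk S [(0, (0, -1)), (0, (1, 0))] ((1, 0) + l • (1, 0)) (1, 0) (0, 1) := by
  obtain ⟨l, hl, hmax⟩ := exists_last_add_nsmul_mem hfin hseg h10 (u := (1, 0)) (by decide)
  have hv : ((1, 0) + l • (1, 0) : ℤ × ℤ) = (1 + (l : ℤ), 0) := by simp
  have hprev : ((1, 0) + l • (1, 0) - (1, 0) : ℤ × ℤ) = 0 + l • (1, 0) := by simp
  refine ⟨l, hl, ⟨hl l le_rfl, fun x hx => ?_⟩, ?_, by simp, ?_,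
    fun x => exists_eq_sub_nsmul_of_last (u := (0, -1)) (by simp [det2]) hmax, h01, ?_, ?_, ?_⟩
  · simpa [hv, det2] using (hquad x hx).2
  · simp only [List.forall_mem_cons, List.not_mem_nil, false_imp_iff, implies_true, and_true]
    exact ⟨⟨h0, fun x hx => by simpa [det2] using (hquad x hx).1⟩,
      ⟨h0, fun x hx => by simpa [det2] using (hquad x hx).2⟩⟩
  · rw [hprev]
    refine hseg (n := l + 1) h0 ?_ l.le_succ
    simpa [add_comm] using hl l le_rfl
  · simp [det2]
  · intro x hx hrow
    obtain ⟨c, hc⟩ := Int.eq_ofNat_of_zero_le (hquad x hx).1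
    refine ⟨c, Prod.ext (by simpa using hc) ?_⟩
    simpa [hv, det2] using hrow
  · intro x hx hxv
    have hx2 : x.2 = 0 := by
      have : 0 ≤ -(x.2 * (1 + l)) := by simpa [hv, det2] using hxv
      nlinarith [(hquad x hx).2]
    have hx1 : x.1 ≤ 1 + l := by
      by_contra! hlt
      obtain ⟨c, hc⟩ := Int.eq_ofNat_of_zero_le (show 0 ≤ x.1 - 1 by omega)
      have := hmax c (by convert hx; ext <;> simp <;> omega)
      omega
    refine mem_latticeHull_of_smul_eq (y := (1, 0) + l • (1, 0)) (z := 0) (n := 1 + l) (a := x.1)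
      (b := 0) (by simp) (by simp) (by simp) (by omega) (hquad x hx).1 le_rfl (by omega) ?_
    ext <;> simp [hx2, mul_comm]

theorem exists_accept_of_allPolygons {accept : List (ℤ × ℤ) → Bool}
    (haccept : allPolygons N accept = true) (hsmooth : HasSmoothVertices (Fin 2) S)
    (hseg : IsSegmentClosed S) (hS : S.encard ≤ N)
    (hquad : ∀ x ∈ S, 0 ≤ x.1 ∧ 0 ≤ x.2) (h0 : 0 ∈ S) (h10 : (1, 0) ∈ S) (h01 : (0, 1) ∈ S) :
    ∃ V, accept V = true ∧ (∀ x ∈ V, x ∈ S) ∧ S ⊆ latticeHull {x | x ∈ V} := by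
  obtain ⟨l, hl, hstart⟩ :=
    exists_isPartialWalk_start (Set.finite_of_encard_le_coe hS) hseg hquad h0 h10 h01
  have hK : IsListOfPoints S [(0, 1), (0, 0)] := ⟨by decide, by simpa using ⟨h01, h0⟩⟩
  obtain ⟨K, hK, hwalks⟩ := hK.exists_of_allAlong hS haccept hl
  exact hstart.exists_accept hsmooth hseg hS hK hwalks

end Search

section Table

/-- The lattice length of a vector: the largest natural number that divides it in `ℤ²`. -/
def latticeLength (x : ℤ × ℤ) : ℕ := Int.gcd x.1 x.2

theorem dvd_latticeLength_iff {n : ℕ} {x : ℤ × ℤ} :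
    n ∣ latticeLength x ↔ ∃ z : ℤ × ℤ, x = (n : ℤ) • z := by
  rw [latticeLength, Int.dvd_gcd_iff]
  exact ⟨fun ⟨⟨a, ha⟩, b, hb⟩ => ⟨(a, b), Prod.ext ha hb⟩,
    fun ⟨z, hz⟩ => hz ▸ ⟨dvd_mul_right _ z.1, dvd_mul_right _ z.2⟩⟩

/-- A corner of a polygon: a vertex together with the primitive directions of the edges that enter
and leave it when the boundary is traversed counterclockwise. -/
structure Corner where
  vertex : ℤ × ℤ
  incoming : ℤ × ℤ
  outgoing : ℤ × ℤ

/-- The corners of the polygon with the vertices `T`, listed counterclockwise. -/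
def corners (T : List (ℤ × ℤ)) : List Corner :=
  (T.zip ((T.rotate 1).zip (T.rotate 2))).map fun (p, v, q) =>
    ⟨v, primitive (v - p), primitive (q - v)⟩
where
  /-- The primitive vector in the direction of `x`, or `0` if `x = 0`. -/
  primitive (x : ℤ × ℤ) : ℤ × ℤ := (x.1 / latticeLength x, x.2 / latticeLength x)

/-- The coordinates of `x` with respect to the corner `c`, in which the edges at `c` lie on the
coordinate axes if `c` is smooth. -/
def Corner.coord (c : Corner) (x : ℤ × ℤ) : ℤ × ℤ :=
  (det2 c.incoming (x - c.vertex), det2 c.outgoing (x - c.vertex))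

/-- The polygon with vertices `T` is smooth at its corner `c`. -/
def Corner.IsSmoothIn (c : Corner) (T : List (ℤ × ℤ)) : Prop :=
  c.vertex ∈ T ∧ det2 c.incoming c.outgoing = 1 ∧
    (∀ x ∈ T, 0 ≤ (c.coord x).1 ∧ 0 ≤ (c.coord x).2) ∧
    (∃ x ∈ T, 0 < (c.coord x).1 ∧ (c.coord x).2 = 0) ∧
    ∃ x ∈ T, (c.coord x).1 = 0 ∧ 0 < (c.coord x).2

instance (c : Corner) (T : List (ℤ × ℤ)) : Decidable (c.IsSmoothIn T) :=
  inferInstanceAs (Decidable (_ ∧ _))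

theorem Corner.IsSmoothIn.isSmoothVertex {c : Corner} {T : List (ℤ × ℤ)} (h : c.IsSmoothIn T) :
    IsSmoothVertex {x | x ∈ T} (cornerBasis h.2.1) c.vertex := by
  obtain ⟨hmem, hdet, hnonneg, ⟨x, hx, hx1, hx2⟩, y, hy, hy1, hy2⟩ := h
  refine ⟨hmem, fun x hx => Fin.forall_fin_two.2 (hnonneg x hx), Fin.forall_fin_two.2
    ⟨⟨(c.coord x).1, hx1, ?_⟩, ⟨(c.coord y).2, hy2, ?_⟩⟩⟩
  · have hxw := eq_add_smul_sub_smul hdet x c.vertex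
    rw [show det2 c.outgoing (x - c.vertex) = 0 from hx2, zero_smul, sub_zero] at hxw
    rw [cornerBasis_zero]
    exact hxw ▸ hx
  · have hyu := eq_add_smul_sub_smul hdet y c.vertex
    rw [show det2 c.incoming (y - c.vertex) = 0 from hy1, zero_smul, add_zero] at hyu
    rw [cornerBasis_one, smul_neg, ← sub_eq_add_neg]
    exact hyu ▸ hy

/-- The vertices of the smooth polygons with at most `12` lattice points, one polygon for each
integral equivalence class. The first `25` are the trapezoids of lattice width one. -/
def smoothPolygonTable : List (List (ℤ × ℤ)) :=
  ([1, 2, 3, 4, 5].flatMap fun a => (List.range (11 - 2 * a)).map fun i =>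
    [(0, 0), (1, 0), (1, (a : ℤ)), (0, (a + i : ℤ))]) ++
  [[(0, 0), (1, 0), (0, 1)],
    [(0, 0), (2, 0), (0, 2)],
    [(0, 0), (3, 0), (0, 3)],
    [(0, 0), (2, 0), (2, 2), (0, 2)],
    [(0, 0), (2, 0), (2, 3), (0, 3)],
    [(0, 0), (2, 0), (2, 2), (0, 4)],
    [(0, 0), (1, 0), (3, 2), (0, 2)],
    [(0, 0), (1, 0), (5, 2), (0, 2)],
    [(0, 0), (1, 0), (2, 1), (2, 2), (0, 2)],
    [(0, 0), (1, 0), (2, 1), (2, 3), (0, 3)],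
    [(0, 0), (1, 0), (2, 1), (2, 2), (0, 4)],
    [(0, 0), (1, 0), (2, 1), (2, 2), (1, 2), (0, 1)],
    [(0, 0), (1, 0), (2, 1), (2, 3), (1, 3), (0, 2)],
    [(0, 0), (1, 0), (2, 1), (2, 2), (1, 3), (0, 3)],
    [(0, 0), (1, 0), (3, 2), (3, 3), (1, 3), (0, 2)],
    [(0, 0), (1, 0), (2, 1), (3, 3), (3, 4), (2, 4), (1, 3), (0, 1)]]

/-- Up to a coordinate change at one of its corners, some polygon of the table has the
vertices `V`. -/
def isListed (table : List (List (ℤ × ℤ))) (V : List (ℤ × ℤ)) : Bool :=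
  table.any fun T => (corners T).any fun c =>
    let L := T.map c.coord
    decide (V ⊆ L ∧ L ⊆ V) || decide (V ⊆ L.map Prod.swap ∧ L.map Prod.swap ⊆ V)

theorem exists_affineEquiv_of_isListed {table : List (List (ℤ × ℤ))} {V : List (ℤ × ℤ)}
    (htable : ∀ T ∈ table, ∀ c ∈ corners T, c.IsSmoothIn T) (hV : isListed table V = true) :
    ∃ T ∈ table, ∃ φ : (ℤ × ℤ) ≃ᵃ[ℤ] ℤ × ℤ, φ '' {x | x ∈ T} = {x | x ∈ V} := by
  simp only [isListed, List.any_eq_true, Bool.or_eq_true, decide_eq_true_eq] at hV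
  obtain ⟨T, hT, c, hc, h⟩ := hV
  let φ : (ℤ × ℤ) ≃ᵃ[ℤ] ℤ × ℤ := (AffineEquiv.vaddConst ℤ c.vertex).symm.trans
    (frameEquiv (htable T hT c hc).2.1).toAffineEquiv
  have himage : ∀ {f : ℤ × ℤ → ℤ × ℤ}, V ⊆ T.map f ∧ T.map f ⊆ V →
      f '' {x | x ∈ T} = {x | x ∈ V} := fun h => by
    ext y
    exact ⟨fun hy => h.2 (List.mem_map.2 hy), fun hy => List.mem_map.1 (h.1 hy)⟩
  rcases h with h | h
  · exact ⟨T, hT, φ, himage h⟩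
  · rw [List.map_map] at h
    exact ⟨T, hT, φ.trans (LinearEquiv.prodComm ℤ ℤ ℤ).toAffineEquiv, himage h⟩

set_option maxRecDepth 10000 in
theorem allPolygons_isListed : allPolygons 12 (isListed smoothPolygonTable) = true := by
  decide +kernel

theorem ne_nil_of_mem_smoothPolygonTable : ∀ T ∈ smoothPolygonTable, T ≠ [] := by
  decide +kernel

theorem nodup_of_mem_smoothPolygonTable : ∀ T ∈ smoothPolygonTable, T.Nodup := by
  decide +kernel

theorem isSmoothIn_of_mem_corners :
    ∀ T ∈ smoothPolygonTable, ∀ c ∈ corners T, c.IsSmoothIn T := by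
  decide +kernel

theorem exists_corner_of_mem :
    ∀ T ∈ smoothPolygonTable, ∀ v ∈ T, ∃ c ∈ corners T, c.vertex = v := by
  decide +kernel

theorem isSmoothVertex_of_mem_smoothPolygonTable {T : List (ℤ × ℤ)} (hT : T ∈ smoothPolygonTable) :
    ∀ v ∈ {x | x ∈ T}, ∃ e : Module.Basis (Fin 2) ℤ (ℤ × ℤ), IsSmoothVertex {x | x ∈ T} e v := by
  intro v hv
  obtain ⟨c, hc, rfl⟩ := exists_corner_of_mem T hT v hv
  exact ⟨_, (isSmoothIn_of_mem_corners T hT c hc).isSmoothVertex⟩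

theorem encard_latticeHull_le {T : List (ℤ × ℤ)} (hT : T ∈ smoothPolygonTable) :
    (latticeHull {x | x ∈ T}).encard ≤ 12 := by
  have hbox : ∀ T ∈ smoothPolygonTable, ∀ x ∈ T, x ∈ Finset.Icc (0, 0) (5, 9) := by
    decide +kernel
  have hcard : ∀ T ∈ smoothPolygonTable, {x ∈ Finset.Icc ((0, 0) : ℤ × ℤ) (5, 9) |
      ∀ c ∈ corners T, 0 ≤ det2 c.outgoing (x - c.vertex)}.card ≤ 12 := by
    decide +kernel
  refine (Set.encard_le_encard fun x hx => ?_).trans ((Set.encard_coe_eq_coe_finsetCard _).trans_le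
    (Nat.cast_le.2 (hcard T hT)))
  have hhalf : ∀ u v, (∀ y ∈ Finset.Icc ((0, 0) : ℤ × ℤ) (5, 9), 0 ≤ det2 u (y - v)) →
      0 ≤ det2 u (x - v) := fun u v huv =>
    det2_nonneg_of_mem_latticeHull (fun y hy => huv y (hbox T hT y hy)) hx
  refine Finset.mem_coe.2 (Finset.mem_filter.2 ⟨?_, fun c hc =>
    det2_nonneg_of_mem_latticeHull
      (fun y hy => ((isSmoothIn_of_mem_corners T hT c hc).2.2.1 y hy).2) hx⟩)
  have h1 := hhalf (1, 0) 0 (by decide +kernel)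
  have h2 := hhalf (0, -1) 0 (by decide +kernel)
  have h3 := hhalf (-1, 0) (5, 9) (by decide +kernel)
  have h4 := hhalf (0, 1) (5, 9) (by decide +kernel)
  simp only [det2, Prod.fst_sub, Prod.snd_sub, Prod.fst_zero, Prod.snd_zero] at h1 h2 h3 h4
  simp only [Finset.mem_Icc, Prod.le_def]
  omega

/-- The sum of the cubes of the lattice lengths of all edges and diagonals of a polygon with the
vertices `T`, each counted twice. Together with the number of vertices it distinguishes the polygons
of the table; the sum of the lattice lengths or of their squares would not suffice. -/
def sumCubeLengths (T : Finset (ℤ × ℤ)) : ℕ := ∑ p ∈ T, ∑ q ∈ T, latticeLength (q - p) ^ 3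

theorem latticeLength_map (f : (ℤ × ℤ) ≃ₗ[ℤ] ℤ × ℤ) (x : ℤ × ℤ) :
    latticeLength (f x) = latticeLength x := by
  have hdvd (g : (ℤ × ℤ) ≃ₗ[ℤ] ℤ × ℤ) (y : ℤ × ℤ) : latticeLength y ∣ latticeLength (g y) := by
    obtain ⟨z, hz⟩ := dvd_latticeLength_iff.1 (dvd_refl (latticeLength y))
    exact dvd_latticeLength_iff.2 ⟨g z, by rw [← map_smul, ← hz]⟩
  exact Nat.dvd_antisymm (by simpa only [f.symm_apply_apply] using hdvd f.symm (f x)) (hdvd f x)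

theorem sumCubeLengths_image (φ : (ℤ × ℤ) ≃ᵃ[ℤ] ℤ × ℤ) (T : Finset (ℤ × ℤ)) :
    sumCubeLengths (T.image φ) = sumCubeLengths T := by
  simp only [sumCubeLengths, Finset.sum_image φ.injective.injOn, affineEquiv_sub,
    latticeLength_map]

theorem nodup_invariants_smoothPolygonTable :
    (smoothPolygonTable.map fun T => (T.length, sumCubeLengths T.toFinset)).Nodup := by
  decide +kernel

end Table

section Classification

theorem HasSmoothVertices.exists_chart {S : Set (Fin 2 → ℤ)} (h : HasSmoothVertices (Fin 2) S)
    (hseg : IsSegmentClosed S) (hfin : S.Finite) (hne : S.Nonempty) :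
    ∃ ψ : (Fin 2 → ℤ) ≃ᵃ[ℤ] ℤ × ℤ, (∀ x ∈ ψ '' S, 0 ≤ x.1 ∧ 0 ≤ x.2) ∧
      0 ∈ ψ '' S ∧ (1, 0) ∈ ψ '' S ∧ (0, 1) ∈ ψ '' S := by
  obtain ⟨v, e, he⟩ := h.exists_isSmoothVertex hfin hne
  let ψ : (Fin 2 → ℤ) ≃ᵃ[ℤ] ℤ × ℤ := (AffineEquiv.vaddConst ℤ v).symm.trans
    (e.equivFun.trans (LinearEquiv.finTwoArrow ℤ ℤ)).toAffineEquiv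
  have hψ : ∀ x, ψ x = (e.repr (x - v) 0, e.repr (x - v) 1) := fun _ => rfl
  refine ⟨ψ, ?_, ⟨v, he.mem, ?_⟩, ⟨v + e 0, he.add_mem hseg 0, ?_⟩,
    ⟨v + e 1, he.add_mem hseg 1, ?_⟩⟩
  · rintro _ ⟨x, hx, rfl⟩
    exact ⟨he.repr_sub_nonneg x hx 0, he.repr_sub_nonneg x hx 1⟩
  all_goals simp [hψ]

theorem exists_integrallyEquivalent_of_allPolygons {N : ℕ} {accept : List (ℤ × ℤ) → Bool}
    (haccept : allPolygons N accept = true) {P : Set (Fin 2 → ℝ)} (hP : IsLatticePolytope P)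
    (hsmooth : IsSmoothPolytope P) (hN : (P ∩ latticeSet 2).encard ≤ N) :
    ∃ V, accept V = true ∧ IntegrallyEquivalent P (planarPolygon {x | x ∈ V}) := by
  rw [encard_inter_latticeSet] at hN
  have hfin : (latticePoints P).Finite := Set.finite_of_encard_le_coe hN
  have hPL := hP.latticePolytope_latticePoints
  have hvert : HasSmoothVertices (Fin 2) (latticePoints P) :=
    IsSmoothPolytope.hasSmoothVertices hfin (by rwa [hPL])
  have hseg : IsSegmentClosed (latticePoints P) :=
    isSegmentClosed_latticePoints (hPL ▸ convex_convexHull ℝ _)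
  obtain ⟨ψ, hquad, h0, h10, h01⟩ := hvert.exists_chart hseg hfin hP.nonempty_latticePoints
  obtain ⟨V, hV, hVS, hSV⟩ := exists_accept_of_allPolygons haccept (hvert.image ψ) (hseg.image ψ)
    (ψ.injective.encard_image _ ▸ hN) hquad h0 h10 h01
  refine ⟨V, hV, ?_⟩
  rw [planarPolygon_eq_of_subset (V := {x | x ∈ V}) hVS hSV]
  simpa only [hPL] using integrallyEquivalent_planarPolygon ψ (latticePoints P)

theorem exists_integrallyEquivalent_mem_smoothPolygonTable {P : Set (Fin 2 → ℝ)}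
    (hP : IsLatticePolytope P) (hsmooth : IsSmoothPolytope P)
    (hN : (P ∩ latticeSet 2).encard ≤ (12 : ℕ)) :
    ∃ T ∈ smoothPolygonTable, IntegrallyEquivalent P (planarPolygon {x | x ∈ T}) := by
  obtain ⟨V, hV, hPV⟩ :=
    exists_integrallyEquivalent_of_allPolygons allPolygons_isListed hP hsmooth hN
  obtain ⟨T, hT, φ, hφ⟩ := exists_affineEquiv_of_isListed isSmoothIn_of_mem_corners hV
  exact ⟨T, hT, hPV.trans' (hφ ▸ (integrallyEquivalent_planarPolygon_image φ _).symm')⟩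

theorem eq_of_integrallyEquivalent_of_mem_smoothPolygonTable {T T' : List (ℤ × ℤ)}
    (hT : T ∈ smoothPolygonTable) (hT' : T' ∈ smoothPolygonTable)
    (h : IntegrallyEquivalent (planarPolygon {x | x ∈ T}) (planarPolygon {x | x ∈ T'})) :
    T = T' := by
  obtain ⟨φ, hφ⟩ := exists_image_eq_of_integrallyEquivalent_planarPolygon
    (isSmoothVertex_of_mem_smoothPolygonTable hT) (isSmoothVertex_of_mem_smoothPolygonTable hT') h
  have himage : T.toFinset.image φ = T'.toFinset := by
    rw [← Finset.coe_inj, Finset.coe_image, List.coe_toFinset, List.coe_toFinset, hφ]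
  refine List.inj_on_of_nodup_map nodup_invariants_smoothPolygonTable hT hT' (Prod.ext ?_ ?_)
  · simp only [← List.toFinset_card_of_nodup (nodup_of_mem_smoothPolygonTable T hT),
      ← List.toFinset_card_of_nodup (nodup_of_mem_smoothPolygonTable T' hT'), ← himage,
      Finset.card_image_of_injective _ φ.injective]
  · simp only [← himage, sumCubeLengths_image]

theorem SmoothPolygon.numVertices_eq {P Q : SmoothPolygon} (h : P ≈ Q) :
    P.numVertices = Q.numVertices := by
  obtain ⟨f, -, hf⟩ := h
  rw [numVertices, numVertices, ← hf, ← affineEquiv_image_extremePoints,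
    f.injective.encard_image]

/-- The smooth polygon with the vertices listed in a row `T` of the table. -/
noncomputable def tablePolygon (T : {T // T ∈ smoothPolygonTable}) : SmoothPolygon :=
  have hvert := isSmoothVertex_of_mem_smoothPolygonTable T.2
  have hne := List.exists_mem_of_ne_nil T.1 (ne_nil_of_mem_smoothPolygonTable T.1 T.2)
  ⟨planarPolygon {x | x ∈ T.1},
    isLatticePolytope_planarPolygon (List.finite_toSet T.1) hne hvert,
    isSmoothPolytope_planarPolygon (List.finite_toSet T.1) hvert⟩

theorem numVertices_tablePolygon (T : {T // T ∈ smoothPolygonTable}) :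
    (tablePolygon T).numVertices = T.1.length := by
  change ((planarPolygon {x | x ∈ T.1}).extremePoints ℝ).encard = _
  rw [extremePoints_planarPolygon (isSmoothVertex_of_mem_smoothPolygonTable T.2),
    intVec_injective.encard_image, ofPair.injective.encard_image, ← List.coe_toFinset,
    Set.encard_coe_eq_coe_finsetCard,
    List.toFinset_card_of_nodup (nodup_of_mem_smoothPolygonTable T.1 T.2)]

theorem numLatticePoints_tablePolygon_le (T : {T // T ∈ smoothPolygonTable}) :
    (tablePolygon T).numLatticePoints ≤ (12 : ℕ) := by
  change (planarPolygon {x | x ∈ T.1} ∩ latticeSet 2).encard ≤ _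
  rw [encard_inter_latticeSet, ← Set.encard_preimage_of_bijective ofPair.bijective]
  exact encard_latticeHull_le T.2

/-- The integral equivalence class of a row of the table. -/
noncomputable def tableClass (T : {T // T ∈ smoothPolygonTable}) : Quotient smoothPolygonSetoid :=
  ⟦tablePolygon T⟧

theorem tableClass_injective : Function.Injective tableClass := fun T T' h =>
  Subtype.ext (eq_of_integrallyEquivalent_of_mem_smoothPolygonTable T.2 T'.2 (Quotient.exact h))

theorem exists_tableClass_eq {P : SmoothPolygon} (hP : P.numLatticePoints ≤ (12 : ℕ)) :
    ∃ T, ⟦P⟧ = tableClass T := by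
  obtain ⟨T, hT, h⟩ := exists_integrallyEquivalent_mem_smoothPolygonTable P.2.1 P.2.2 hP
  exact ⟨⟨T, hT⟩, Quotient.sound h⟩

theorem smoothPolygonClasses_twelve : smoothPolygonClasses 12 = Set.range tableClass := by
  ext c
  constructor
  · rintro ⟨P, hP, rfl⟩
    obtain ⟨T, hT⟩ := exists_tableClass_eq hP
    exact ⟨T, hT.symm⟩
  · rintro ⟨T, rfl⟩
    exact ⟨_, numLatticePoints_tablePolygon_le T, rfl⟩

theorem smoothPolygonClassesWithVertices_twelve (n : ℕ) :
    smoothPolygonClassesWithVertices 12 n = tableClass '' {T | T.1.length = n} := by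
  ext c
  constructor
  · rintro ⟨P, hP, hn, rfl⟩
    obtain ⟨T, hT⟩ := exists_tableClass_eq hP
    rw [SmoothPolygon.numVertices_eq (Quotient.exact hT), numVertices_tablePolygon,
      Nat.cast_inj] at hn
    exact ⟨T, hn, hT.symm⟩
  · rintro ⟨T, hn, rfl⟩
    refine ⟨_, numLatticePoints_tablePolygon_le T, ?_, rfl⟩
    rw [numVertices_tablePolygon, hn]

theorem encard_subtype_mem_list {α : Type*} {l : List α} (hl : l.Nodup)
    (p : α → Prop) [DecidablePred p] : {x : {x // x ∈ l} | p x}.encard = l.countP p := by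
  classical
  have himage : (↑) '' {x : {x // x ∈ l} | p x} = ((l.filter p).toFinset : Set α) := by
    ext x
    simp [and_comm]
  rw [← Subtype.val_injective.encard_image, himage, Set.encard_coe_eq_coe_finsetCard,
    List.toFinset_card_of_nodup (hl.filter _), List.countP_eq_length_filter]

theorem encard_smoothPolygonClasses_twelve :
    (smoothPolygonClasses 12).encard = smoothPolygonTable.length := by
  have hcount := encard_subtype_mem_list nodup_invariants_smoothPolygonTable.of_map fun _ => True
  rw [smoothPolygonClasses_twelve, ← Set.image_univ, tableClass_injective.encard_image]
  simpa using hcount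

theorem encard_smoothPolygonClassesWithVertices_twelve (n : ℕ) :
    (smoothPolygonClassesWithVertices 12 n).encard =
      smoothPolygonTable.countP (fun T => T.length = n) := by
  rw [smoothPolygonClassesWithVertices_twelve, tableClass_injective.encard_image]
  exact encard_subtype_mem_list nodup_invariants_smoothPolygonTable.of_map fun T => T.length = n

end Classification

theorem mainTheorem9 :
    (smoothPolygonClasses 12).encard = 41 ∧
    (smoothPolygonClassesWithVertices 12 3).encard = 3 ∧
    (smoothPolygonClassesWithVertices 12 4).encard = 30 ∧
    (smoothPolygonClassesWithVertices 12 5).encard = 3 ∧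
    (smoothPolygonClassesWithVertices 12 6).encard = 4 ∧
    (smoothPolygonClassesWithVertices 12 7).encard = 0 ∧
    (smoothPolygonClassesWithVertices 12 8).encard = 1 ∧
    ∀ n : ℕ, 9 ≤ n → (smoothPolygonClassesWithVertices 12 n).encard = 0 := by
  have hlength : ∀ T ∈ smoothPolygonTable, T.length ≤ 8 := by decide +kernel
  simp only [encard_smoothPolygonClasses_twelve, encard_smoothPolygonClassesWithVertices_twelve]
  refine ⟨rfl, rfl, rfl, rfl, rfl, rfl, rfl, fun n hn => ?_⟩
  rw [Nat.cast_eq_zero, List.countP_eq_zero]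
  intro T hT
  have := hlength T hT
  simp only [decide_eq_true_eq]
  omega
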